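/- A finite cover of a topological space $X$ is a surjective covering map $E\to X$ with finite fibers. A topological space $N$ satisfies condition (*) if for every integer $i>0$, every finite abelian group $T$, every finite cover $\hat p:\hat N\to N$ and every singular cohomology class $x\in H^i(\hat N;T)$, there is a finite cover $\tilde p:\tilde N\to\hat N$ such that $\tilde p^{*}x=0$ in $H^i(\tilde N;T)$. Lemma. Let $G$ be a simply connected nilpotent (finite-dimensional, real) Lie group and $L\subset G$ a discrete subgroup with $G/L$ compact. Then the nilmanifold $G/L$ satisfies condition (*). -/

import Mathlib

open scoped Manifold ContDiff

universe u v w e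

noncomputable section

namespace SingularCohomology

/-- Singular `n`-simplices of `X`: continuous maps from the standard topological `n`-simplex. -/
abbrev Simplex (n : ℕ) (X : Type*) [TopologicalSpace X] :=
  C(stdSimplex ℝ (Fin (n + 1)), X)

/-- The inclusion of the standard `n`-simplex as the `i`-th face of the standard
`(n + 1)`-simplex (the face opposite to the vertex `i`). -/
def face (n : ℕ) (i : Fin (n + 2)) :
    C(stdSimplex ℝ (Fin (n + 1)), stdSimplex ℝ (Fin (n + 2))) :=
  ⟨stdSimplex.map i.succAbove, stdSimplex.continuous_map i.succAbove⟩

/-- Singular `n`-cochains of `X` with coefficients in `T`: since the singular chain group is free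
on the singular simplices, these are arbitrary `T`-valued functions of singular simplices. -/
abbrev Cochain (n : ℕ) (X : Type*) [TopologicalSpace X] (T : Type*) :=
  Simplex n X → T

variable {X Y Z : Type*} [TopologicalSpace X] [TopologicalSpace Y] [TopologicalSpace Z]
variable {T : Type*} [AddCommGroup T]

/-- The coboundary, `(δ φ)(σ) = ∑ i, (-1) ^ i φ(σ ∘ dᵢ)`. -/
def coboundary (n : ℕ) (X : Type*) [TopologicalSpace X] (T : Type*) [AddCommGroup T] :
    Cochain n X T →+ Cochain (n + 1) X T where
  toFun φ σ := ∑ i : Fin (n + 2), (-1 : ℤ) ^ (i : ℕ) • φ (σ.comp (face n i))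
  map_zero' := by ext σ; simp
  map_add' φ ψ := by ext σ; simp [Finset.sum_add_distrib]

/-- Pullback of cochains along a continuous map, `(f^* φ)(σ) = φ(f ∘ σ)`. -/
def cochainPullback (n : ℕ) (T : Type*) [AddCommGroup T] (f : C(X, Y)) :
    Cochain n Y T →+ Cochain n X T where
  toFun φ σ := φ (f.comp σ)
  map_zero' := rfl
  map_add' _ _ := rfl

theorem face_comp_face (n : ℕ) (i : Fin (n + 2)) (j : Fin (n + 3)) (h : (j : ℕ) ≤ i) :
    (face (n + 1) j).comp (face n i) =
      (face (n + 1) i.succ).comp (face n (j.castLT (lt_of_le_of_lt h i.is_lt))) := by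
  ext1 x
  simp only [ContinuousMap.comp_apply, face, ContinuousMap.coe_mk, stdSimplex.map_comp_apply]
  congr 1
  funext k
  simp only [Function.comp_apply, Fin.ext_iff, Fin.succAbove, Fin.lt_def, Fin.val_castSucc,
    Fin.val_succ, Fin.val_castLT]
  split_ifs <;> simp_all <;> omega

theorem coboundary_coboundary (n : ℕ) (φ : Cochain n X T) :
    coboundary (n + 1) X T (coboundary n X T φ) = 0 := by
  ext σ
  simp only [coboundary, AddMonoidHom.coe_mk, ZeroHom.coe_mk, Finset.smul_sum, smul_smul,
    Pi.zero_apply]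
  rw [Finset.sum_comm]
  simp only [← Finset.sum_product']
  let P := Fin (n + 2) × Fin (n + 3)
  let S : Finset P := {ij : P | (ij.2 : ℕ) ≤ (ij.1 : ℕ)}
  rw [Finset.univ_product_univ, ← Finset.sum_add_sum_compl S, ← eq_neg_iff_add_eq_zero,
    ← Finset.sum_neg_distrib]
  let e : ∀ ij : P, ij ∈ S → P := fun ij hij =>
    (Fin.castLT ij.2 (lt_of_le_of_lt (Finset.mem_filter.mp hij).right (Fin.is_lt ij.1)), ij.1.succ)
  apply Finset.sum_bij e
  · intro ij hij
    simp_rw [S, e, Finset.compl_filter, Finset.mem_filter_univ, Fin.val_succ,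
      Fin.val_castLT] at hij ⊢
    lia
  · rintro ⟨i, j⟩ hij ⟨i', j'⟩ hij' h
    rw [Prod.mk_inj]
    exact ⟨by simpa [e] using congr_arg Prod.snd h,
      by simpa [e, Fin.castSucc_castLT] using congr_arg Fin.castSucc (congr_arg Prod.fst h)⟩
  · rintro ⟨i', j'⟩ hij'
    simp_rw [S, Finset.compl_filter, Finset.mem_filter_univ, not_le] at hij'
    refine ⟨(j'.pred <| ?_, Fin.castSucc i'), ?_, ?_⟩
    · rintro rfl
      simp only [Fin.val_zero, not_lt_zero] at hij'
    · simpa [S] using Nat.le_sub_one_of_lt hij'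
    · simp only [e, Fin.castLT_castSucc, Fin.succ_pred]
  · rintro ⟨i, j⟩ hij
    have h : (j : ℕ) ≤ i := (Finset.mem_filter.mp hij).right
    simp only [ContinuousMap.comp_assoc, e]
    rw [face_comp_face n i j h, ← neg_smul]
    congr 1
    simp only [Fin.val_succ, Fin.val_castLT]
    ring

theorem coboundary_cochainPullback (n : ℕ) (f : C(X, Y)) (φ : Cochain n Y T) :
    coboundary n X T (cochainPullback n T f φ) =
      cochainPullback (n + 1) T f (coboundary n Y T φ) := rfl

/-- The `n`-cocycles. -/
def cocycles (n : ℕ) (X : Type*) [TopologicalSpace X] (T : Type*) [AddCommGroup T] :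
    AddSubgroup (Cochain n X T) :=
  (coboundary n X T).ker

/-- The `n`-coboundaries: zero for `n = 0`, and the image of the coboundary from degree `n - 1`
otherwise. -/
def coboundaries (n : ℕ) (X : Type*) [TopologicalSpace X] (T : Type*) [AddCommGroup T] :
    AddSubgroup (Cochain n X T) :=
  match n with
  | 0 => ⊥
  | m + 1 => (coboundary m X T).range

theorem coboundaries_le_cocycles (n : ℕ) :
    coboundaries n X T ≤ cocycles n X T := by
  cases n with
  | zero => exact bot_le
  | succ m =>
    rintro _ ⟨φ, rfl⟩
    exact coboundary_coboundary m φ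

/-- Singular cohomology `H^n(X; T)`: cocycles modulo coboundaries. -/
abbrev Cohomology (n : ℕ) (X : Type*) [TopologicalSpace X] (T : Type*) [AddCommGroup T] :=
  cocycles n X T ⧸ (coboundaries n X T).addSubgroupOf (cocycles n X T)

/-- Pullback of cocycles. -/
def cocyclesPullback (n : ℕ) (T : Type*) [AddCommGroup T] (f : C(X, Y)) :
    cocycles n Y T →+ cocycles n X T :=
  ((cochainPullback n T f).comp (cocycles n Y T).subtype).codRestrict (cocycles n X T) (by
    rintro ⟨φ, hφ⟩
    change coboundary n X T (cochainPullback n T f φ) = 0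
    rw [coboundary_cochainPullback, show coboundary n Y T φ = 0 from hφ, map_zero])

/-- The homomorphism `f^* : H^n(Y; T) → H^n(X; T)` induced by a continuous map `f : X → Y`. -/
def pullback (n : ℕ) (T : Type*) [AddCommGroup T] (f : C(X, Y)) :
    Cohomology n Y T →+ Cohomology n X T :=
  QuotientAddGroup.map _ _ (cocyclesPullback n T f) (by
    rintro ⟨φ, hφ⟩ h
    cases n with
    | zero =>
      have h0 : φ = 0 := h
      subst h0
      exact AddSubgroup.zero_mem _
    | succ m =>
      obtain ⟨ψ, hψ⟩ := h
      exact ⟨cochainPullback m T f ψ, by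
        rw [coboundary_cochainPullback, hψ]; rfl⟩)

end SingularCohomology

/-- A finite cover: a surjective covering map with finite fibers. -/
structure IsFiniteCover {E X : Type*} [TopologicalSpace E] [TopologicalSpace X]
    (p : C(E, X)) : Prop where
  isCoveringMap : IsCoveringMap p
  surjective : Function.Surjective p
  finite_fiber : ∀ x : X, (p ⁻¹' {x}).Finite

/-- Condition (*): for every `i > 0`, every finite abelian group `T`, every finite cover
`N' → N` and every `x ∈ H^i(N'; T)` there is a finite cover `p : N'' → N'` with `p^* x = 0`. -/
def ConditionStar.{u₁, u₂, u₃} (N : Type u₁) [TopologicalSpace N] : Prop :=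
  ∀ i : ℕ, 0 < i → ∀ (T : Type u₂) [AddCommGroup T] [Finite T]
    (N' : Type u₃) [TopologicalSpace N'] (q : C(N', N)), IsFiniteCover q →
    ∀ x : SingularCohomology.Cohomology i N' T,
      ∃ (N'' : Type u₃) (_ : TopologicalSpace N'') (p : C(N'', N')),
        IsFiniteCover p ∧ SingularCohomology.pullback i T p x = 0

end

/-!
Every cocycle on a finite cover of `G ⧸ L` is pulled back to `G`, filled there, and the primitive is
brought down to a finite cover again. This works once the singular cochains of `G` fixed by some
finite-index subgroup of `L` (the almost invariant ones) form a complex that is acyclic in positive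
degrees: the pullback of a cocycle along each of the finitely many lifts `G → N` to a finite cover
`N` of `G ⧸ L` is almost invariant, so it has a primitive invariant under a subgroup `M` of finite
index in `L`, and finitely many copies of `G ⧸ M` form the required cover of `N`
(`SingularCohomology.conditionStar_of_almostInvariantAcyclic`).

The lattice `L` is finitely generated, as `G` is connected and `G ⧸ L` is compact
(`Subgroup.fg_of_discrete_of_cocompact`), and nilpotent, so it is built from the trivial group by
successively adjoining elements normalizing what is already there
(`Subgroup.isPolycyclic_of_fg_of_isNilpotent`). Acyclicity of almost invariant cochains is proved
along this chain, `SingularCohomology.AlmostInvariantAcyclic.sup_zpowers`. In passing from `K` to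
`⟨K, t⟩`, a primitive that is almost invariant under `K` is corrected so that a power of `t` fixes
it as well. In positive degrees the correction comes from solving a difference equation along free
`ℤ`-orbits of simplices; in degree zero the obstruction is a constant in the coefficient group `T`,
and the power `|T|` kills it. This is where passing to finite covers and finiteness of `T` matter.

The chain starts with the trivial group, that is, with the acyclicity of `G`. The exponential map is
avoided: it is enough that every compact subset of `G` lies in an embedded copy of the model space
(`SingularCohomology.exists_coboundary_eq`), and such copies are obtained by spreading a chart
around `1` with iterated squaring. Squaring is a local homeomorphism because `Ad g` is unipotent, so
that `Ad g + 1` is invertible (`isLocalHomeomorph_mul_self`). It is then a covering map whose deck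
group consists of central elements of order at most two, so a homeomorphism by simple connectedness
(`exists_homeomorph_mul_self`). Its derivative at `1` is `2`, and its inverse contracts a
neighborhood of `1` to `1`; by nilpotency it then contracts every compact set
(`Subgroup.tendsto_iterate_root`, `compactsInCopiesOf_of_expanding`).
-/

noncomputable section

/-! ### Singular homology of spaces whose compact subsets lie in copies of a vector space -/

namespace SingularCohomology

variable {X Y : Type*} [TopologicalSpace X] [TopologicalSpace Y]

/-- Integral singular `n`-chains. -/
abbrev Chain (n : ℕ) (X : Type*) [TopologicalSpace X] := FreeAbelianGroup (Simplex n X)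

/-- The boundary of singular chains. On a simplex it is the coboundary of the tautological
chain-valued cochain, so its properties follow from those of `coboundary`. -/
def boundary (n : ℕ) (X : Type*) [TopologicalSpace X] : Chain (n + 1) X →+ Chain n X :=
  FreeAbelianGroup.lift (coboundary n X (Chain n X) FreeAbelianGroup.of)

theorem coboundary_apply {T : Type*} [AddCommGroup T] {n : ℕ} (φ : Cochain n X T)
    (σ : Simplex (n + 1) X) :
    coboundary n X T φ σ = ∑ i : Fin (n + 2), (-1 : ℤ) ^ (i : ℕ) • φ (σ.comp (face n i)) := rfl

theorem boundary_of {n : ℕ} (σ : Simplex (n + 1) X) :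
    boundary n X (FreeAbelianGroup.of σ) =
      ∑ i : Fin (n + 2), (-1 : ℤ) ^ (i : ℕ) • FreeAbelianGroup.of (σ.comp (face n i)) := by
  simp [boundary, coboundary_apply]

/-- Evaluation of cochains on chains turns the coboundary into the boundary. -/
theorem lift_boundary {T : Type*} [AddCommGroup T] {n : ℕ} (φ : Cochain n X T)
    (c : Chain (n + 1) X) :
    FreeAbelianGroup.lift φ (boundary n X c) = FreeAbelianGroup.lift (coboundary n X T φ) c := by
  refine DFunLike.congr_fun (f := (FreeAbelianGroup.lift φ).comp (boundary n X)) ?_ c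
  refine FreeAbelianGroup.lift_ext _ _ fun σ => ?_
  simp [boundary_of, coboundary_apply]

theorem boundary_boundary {n : ℕ} (c : Chain (n + 2) X) :
    boundary n X (boundary (n + 1) X c) = 0 := by
  rw [boundary, lift_boundary, coboundary_coboundary]
  induction c using FreeAbelianGroup.induction_on <;> simp_all

/-- Pushforward of chains along a continuous map. -/
def chainMap (n : ℕ) (f : C(X, Y)) : Chain n X →+ Chain n Y :=
  FreeAbelianGroup.map f.comp

theorem chainMap_boundary {n : ℕ} (f : C(X, Y)) (c : Chain (n + 1) X) :
    chainMap n f (boundary n X c) = boundary n Y (chainMap (n + 1) f c) := by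
  refine DFunLike.congr_fun (f := (chainMap n f).comp (boundary n X))
    (g := (boundary n Y).comp (chainMap (n + 1) f)) ?_ c
  refine FreeAbelianGroup.lift_ext _ _ fun σ => ?_
  simp [boundary_of, chainMap, FreeAbelianGroup.map_of_apply, ContinuousMap.comp_assoc]

theorem chainMap_injective {n : ℕ} {f : C(X, Y)} (hf : Function.Injective f) :
    Function.Injective (chainMap n f) := by
  have hf' : Function.Injective (f.comp : Simplex n X → Simplex n Y) := fun σ τ h =>
    ContinuousMap.ext fun x => hf (DFunLike.congr_fun h x)
  rcases isEmpty_or_nonempty (Simplex n X) with h | h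
  · have h0 : AddMonoidHom.id (Chain n X) = 0 := FreeAbelianGroup.lift_ext _ _ isEmptyElim
    have : Subsingleton (Chain n X) :=
      subsingleton_of_forall_eq 0 fun c => DFunLike.congr_fun h0 c
    exact Function.injective_of_subsingleton _
  · refine Function.LeftInverse.injective (g := FreeAbelianGroup.map (Function.invFun
      (f.comp : Simplex n X → Simplex n Y))) fun c => ?_
    rw [chainMap, ← FreeAbelianGroup.map_comp_apply, Function.invFun_comp hf',
      FreeAbelianGroup.map_id_apply]

/-- The join parametrization `(s, x) ↦ (s, (1 - s) x)` of the `(n + 1)`-simplex by a segment times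
the `n`-simplex; it collapses `{1} × Δⁿ` to the vertex `0`. -/
def join (n : ℕ) : C(unitInterval × stdSimplex ℝ (Fin (n + 1)), stdSimplex ℝ (Fin (n + 2))) where
  toFun p := ⟨Fin.cons (p.1 : ℝ) fun i => (1 - p.1) * p.2 i, by
    refine ⟨fun i => ?_, ?_⟩
    · refine Fin.cases ?_ (fun i => ?_) i
      · exact p.1.2.1
      · exact mul_nonneg (sub_nonneg.2 p.1.2.2) (p.2.2.1 i)
    · rw [Fin.sum_univ_succ]
      simp only [Fin.cons_zero, Fin.cons_succ, ← Finset.mul_sum]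
      rw [show ∑ i, p.2 i = 1 from p.2.2.2]
      ring⟩
  continuous_toFun := by
    refine Continuous.subtype_mk (continuous_pi fun i => ?_) _
    refine Fin.cases ?_ (fun i => ?_) i
    · simp only [Fin.cons_zero]
      fun_prop
    · simp only [Fin.cons_succ]
      have : Continuous fun p : unitInterval × stdSimplex ℝ (Fin (n + 1)) => p.2 i :=
        (continuous_apply i).comp (continuous_subtype_val.comp continuous_snd)
      fun_prop

theorem join_zero_coord {n : ℕ} (s : unitInterval) (x : stdSimplex ℝ (Fin (n + 1))) :
    join n (s, x) 0 = s := rfl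

theorem join_succ_coord {n : ℕ} (s : unitInterval) (x : stdSimplex ℝ (Fin (n + 1)))
    (i : Fin (n + 1)) : join n (s, x) i.succ = (1 - s) * x i := rfl

theorem join_surjective (n : ℕ) : Function.Surjective (join n) := by
  intro t
  have hs : ∑ i : Fin (n + 1), t i.succ = 1 - t 0 := by
    have := stdSimplex.sum_eq_one t
    rw [Fin.sum_univ_succ] at this
    linarith
  have h01 : t 0 ∈ unitInterval := ⟨stdSimplex.zero_le t 0, stdSimplex.le_one t 0⟩
  by_cases h : t 0 = 1
  · refine ⟨(⟨t 0, h01⟩, Classical.arbitrary _), stdSimplex.ext (funext fun i => ?_)⟩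
    have h0 : ∀ i : Fin (n + 1), t i.succ = 0 := by
      rw [h, sub_self] at hs
      intro i
      exact (Finset.sum_eq_zero_iff_of_nonneg fun i _ => stdSimplex.zero_le t _).1 hs i
        (Finset.mem_univ i)
    refine Fin.cases ?_ (fun i => ?_) i
    · rfl
    · rw [join_succ_coord, h0]
      simp [h]
  · have h1 : 1 - t 0 ≠ 0 := fun h' => h (by linarith)
    refine ⟨(⟨t 0, h01⟩, ⟨fun i => t i.succ / (1 - t 0), fun i => ?_, ?_⟩),
      stdSimplex.ext (funext fun i => ?_)⟩
    · exact div_nonneg (stdSimplex.zero_le t _) (sub_nonneg.2 (stdSimplex.le_one t 0))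
    · rw [← Finset.sum_div, hs, div_self h1]
    · refine Fin.cases ?_ (fun i => ?_) i
      · rfl
      · rw [join_succ_coord]
        exact mul_div_cancel₀ _ h1

theorem isQuotientMap_join (n : ℕ) : Topology.IsQuotientMap (join n) :=
  (join n).continuous.isClosedMap.isQuotientMap (join n).continuous (join_surjective n)

theorem face_apply {n : ℕ} (i : Fin (n + 2)) (x : stdSimplex ℝ (Fin (n + 1))) (j : Fin (n + 2)) :
    face n i x j = ∑ k with i.succAbove k = j, x k := by
  simp [face, stdSimplex.map_coe, FunOnFinite.linearMap_apply_apply]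

theorem face_succAbove {n : ℕ} (i : Fin (n + 2)) (x : stdSimplex ℝ (Fin (n + 1)))
    (k : Fin (n + 1)) : face n i x (i.succAbove k) = x k := by
  rw [face_apply, Finset.sum_eq_single k] <;> simp +contextual

theorem face_self {n : ℕ} (i : Fin (n + 2)) (x : stdSimplex ℝ (Fin (n + 1))) :
    face n i x i = 0 := by
  rw [face_apply]
  refine Finset.sum_eq_zero fun k hk => ?_
  exact absurd (Finset.mem_filter.1 hk).2 (Fin.succAbove_ne i k)

theorem face_zero_eq_join {n : ℕ} (x : stdSimplex ℝ (Fin (n + 1))) :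
    face n 0 x = join n (0, x) := by
  refine stdSimplex.ext (funext fun j => Fin.cases ?_ (fun k => ?_) j)
  · rw [face_self, join_zero_coord]; rfl
  · rw [join_succ_coord, ← Fin.succAbove_zero_apply, face_succAbove]
    simp

theorem face_succ_join {n : ℕ} (i : Fin (n + 2)) (s : unitInterval)
    (x : stdSimplex ℝ (Fin (n + 1))) :
    face (n + 1) i.succ (join n (s, x)) = join (n + 1) (s, face n i x) := by
  refine stdSimplex.ext (funext fun j => ?_)
  rcases Fin.eq_self_or_eq_succAbove i.succ j with rfl | ⟨k, rfl⟩
  · rw [face_self, join_succ_coord, face_self, mul_zero]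
  · rw [face_succAbove]
    refine Fin.cases ?_ (fun k => ?_) k
    · rw [Fin.succ_succAbove_zero]; rfl
    · rw [Fin.succ_succAbove_succ, join_succ_coord, join_succ_coord, face_succAbove]

section Cone

variable {E : Type*} [NormedAddCommGroup E] [NormedSpace ℝ E]

theorem factorsThrough_join {n : ℕ} (σ : Simplex n E) : Function.FactorsThrough
    (fun p : unitInterval × stdSimplex ℝ (Fin (n + 1)) => (1 - (p.1 : ℝ)) • σ p.2) (join n) := by
  rintro ⟨s, x⟩ ⟨s', x'⟩ h
  have h0 : (s : ℝ) = s' := congrArg (fun t : stdSimplex ℝ (Fin (n + 2)) => t 0) h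
  by_cases h1 : (1 - s : ℝ) = 0
  · simp [← h0, h1]
  · have : x = x' := stdSimplex.ext (funext fun i => by
      have := congrArg (fun t : stdSimplex ℝ (Fin (n + 2)) => t i.succ) h
      simp only [join_succ_coord, ← h0] at this
      exact mul_left_cancel₀ h1 this)
    simp [this, h0]

/-- The cone over a singular simplex of a vector space, with apex `0` as vertex `0`. -/
def cone {n : ℕ} (σ : Simplex n E) : Simplex (n + 1) E :=
  (isQuotientMap_join n).lift ⟨fun p => (1 - (p.1 : ℝ)) • σ p.2, by fun_prop⟩
    (factorsThrough_join σ)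

theorem cone_join {n : ℕ} (σ : Simplex n E) (s : unitInterval) (x : stdSimplex ℝ (Fin (n + 1))) :
    cone σ (join n (s, x)) = (1 - (s : ℝ)) • σ x :=
  DFunLike.congr_fun ((isQuotientMap_join n).lift_comp
    ⟨fun p => (1 - (p.1 : ℝ)) • σ p.2, by fun_prop⟩ (factorsThrough_join σ)) (s, x)

theorem cone_comp_face_zero {n : ℕ} (σ : Simplex n E) : (cone σ).comp (face n 0) = σ := by
  ext x
  simp [face_zero_eq_join, cone_join]

theorem cone_comp_face_succ {n : ℕ} (σ : Simplex (n + 1) E) (i : Fin (n + 2)) :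
    (cone σ).comp (face (n + 1) i.succ) = cone (σ.comp (face n i)) := by
  ext t
  obtain ⟨⟨s, x⟩, rfl⟩ := join_surjective n t
  simp [face_succ_join, cone_join]

/-- Coning is a contracting homotopy in positive degrees. -/
theorem boundary_cone {n : ℕ} (c : Chain (n + 1) E) :
    boundary (n + 1) E (FreeAbelianGroup.map cone c) =
      c - FreeAbelianGroup.map cone (boundary n E c) := by
  refine DFunLike.congr_fun (f := (boundary (n + 1) E).comp (FreeAbelianGroup.map cone))
    (g := AddMonoidHom.id _ - (FreeAbelianGroup.map cone).comp (boundary n E)) ?_ c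
  refine FreeAbelianGroup.lift_ext _ _ fun σ => ?_
  simp only [AddMonoidHom.comp_apply, FreeAbelianGroup.map_of_apply, boundary_of,
    AddMonoidHom.sub_apply, AddMonoidHom.id_apply, map_sum, map_zsmul]
  rw [Fin.sum_univ_succ]
  simp [cone_comp_face_zero, cone_comp_face_succ, pow_succ, sub_eq_add_neg]

/-- The positive-degree homology of a vector space vanishes. -/
theorem exists_boundary_eq_of_normedSpace {n : ℕ} (c : Chain (n + 1) E)
    (hc : boundary n E c = 0) : ∃ b, boundary (n + 1) E b = c :=
  ⟨FreeAbelianGroup.map cone c, by rw [boundary_cone, hc, map_zero, sub_zero]⟩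

theorem boundary_cone_zero (σ : Simplex 0 E) :
    boundary 0 E (FreeAbelianGroup.of (cone σ)) =
      FreeAbelianGroup.of σ - FreeAbelianGroup.of (.const _ 0) := by
  have h : (cone σ).comp (face 0 1) = .const _ 0 := by
    ext x
    have : face 0 1 x = join 0 (1, x) := by
      refine stdSimplex.ext (funext fun j => ?_)
      rcases Fin.eq_self_or_eq_succAbove 1 j with rfl | ⟨k, rfl⟩
      · rw [face_self, ← Fin.succ_zero_eq_one, join_succ_coord]; simp
      · rw [face_succAbove]
        have hk : k = 0 := Subsingleton.elim _ _
        subst hk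
        rw [show x 0 = 1 from stdSimplex.eq_one_of_unique (X := Fin 1) x 0]
        rfl
    simp [this, cone_join]
  rw [boundary_of, Fin.sum_univ_two, h, cone_comp_face_zero]
  simp [sub_eq_add_neg]

end Cone

section Acyclic

/-- Every compact subset of `X` lies in an embedded copy of `E`. -/
def CompactsInCopiesOf (E X : Type*) [TopologicalSpace E] [TopologicalSpace X] : Prop :=
  ∀ K : Set X, IsCompact K → ∃ j : C(E, X), Topology.IsEmbedding j ∧ K ⊆ Set.range j

/-- A singular chain lies in every embedded copy of `E` that contains a suitable compact set. -/
theorem exists_isCompact_mem_range_chainMap {E : Type*} [TopologicalSpace E] {n : ℕ}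
    (c : Chain n X) : ∃ K : Set X, IsCompact K ∧
      ∀ j : C(E, X), Topology.IsEmbedding j → K ⊆ Set.range j → c ∈ (chainMap n j).range := by
  induction c using FreeAbelianGroup.induction_on with
  | zero => exact ⟨∅, isCompact_empty, fun j _ _ => zero_mem _⟩
  | of σ =>
    refine ⟨Set.range σ, isCompact_range σ.continuous, fun j hj hK => ?_⟩
    choose g hg using fun x => hK (Set.mem_range_self x)
    have hg' : j ∘ g = σ := funext hg
    have gc : Continuous g := hj.continuous_iff.2 (hg' ▸ σ.continuous)
    refine ⟨FreeAbelianGroup.of ⟨g, gc⟩, ?_⟩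
    rw [chainMap, FreeAbelianGroup.map_of_apply]
    exact congrArg _ (ContinuousMap.ext hg)
  | neg σ h =>
    obtain ⟨K, hK, h⟩ := h
    exact ⟨K, hK, fun j hj hj' => neg_mem (h j hj hj')⟩
  | add a b ha hb =>
    obtain ⟨K, hK, ha⟩ := ha
    obtain ⟨K', hK', hb⟩ := hb
    exact ⟨K ∪ K', hK.union hK', fun j hj hj' => add_mem
      (ha j hj (Set.subset_union_left.trans hj')) (hb j hj (Set.subset_union_right.trans hj'))⟩

variable {E : Type*} [NormedAddCommGroup E] [NormedSpace ℝ E]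

theorem exists_boundary_eq (hX : CompactsInCopiesOf E X) {n : ℕ} (c : Chain (n + 1) X)
    (hc : boundary n X c = 0) : ∃ b, boundary (n + 1) X b = c := by
  obtain ⟨K, hK, h⟩ := exists_isCompact_mem_range_chainMap (E := E) c
  obtain ⟨j, hj, hj'⟩ := hX K hK
  obtain ⟨c, rfl⟩ := h j hj hj'
  rw [← chainMap_boundary, ← map_zero (chainMap n j)] at hc
  obtain ⟨b, rfl⟩ := exists_boundary_eq_of_normedSpace c (chainMap_injective hj.injective hc)
  exact ⟨chainMap _ j b, by rw [chainMap_boundary]⟩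

theorem exists_boundary_eq_sub (hX : CompactsInCopiesOf E X) (σ τ : Simplex 0 X) :
    ∃ b, boundary 0 X b = FreeAbelianGroup.of σ - FreeAbelianGroup.of τ := by
  obtain ⟨j, hj, hj'⟩ := hX (Set.range σ ∪ Set.range τ)
    ((isCompact_range σ.continuous).union (isCompact_range τ.continuous))
  have key : ∀ ρ : Simplex 0 X, Set.range ρ ⊆ Set.range j → ∃ ρ' : Simplex 0 E, j.comp ρ' = ρ := by
    intro ρ hρ
    choose g hg using fun x => hρ (Set.mem_range_self x)
    have hg' : j ∘ g = ρ := funext hg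
    exact ⟨⟨g, hj.continuous_iff.2 (hg' ▸ ρ.continuous)⟩, ContinuousMap.ext hg⟩
  obtain ⟨σ, rfl⟩ := key σ (Set.subset_union_left.trans hj')
  obtain ⟨τ, rfl⟩ := key τ (Set.subset_union_right.trans hj')
  refine ⟨chainMap 1 j (FreeAbelianGroup.of (cone σ) - FreeAbelianGroup.of (cone τ)), ?_⟩
  rw [← chainMap_boundary, map_sub, boundary_cone_zero, boundary_cone_zero,
    sub_sub_sub_cancel_right, map_sub]
  rfl

/-- Boundaries in degree `n` can be filled additively. As the chain groups are free, this follows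
degree by degree from the vanishing of homology. -/
theorem exists_boundary_section (hX : CompactsInCopiesOf E X) [Nonempty X] (n : ℕ) :
    ∃ h : Chain n X →+ Chain (n + 1) X,
      ∀ c, boundary n X (h (boundary n X c)) = boundary n X c := by
  induction n with
  | zero =>
    let p : Simplex 0 X := .const _ (Classical.arbitrary X)
    choose h hh using fun σ => exists_boundary_eq_sub hX σ p
    refine ⟨FreeAbelianGroup.lift h, fun c => ?_⟩
    refine DFunLike.congr_fun (f := ((boundary 0 X).comp (FreeAbelianGroup.lift h)).comp
      (boundary 0 X)) (g := boundary 0 X) (FreeAbelianGroup.lift_ext _ _ fun σ => ?_) c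
    simp only [AddMonoidHom.comp_apply, boundary_of, map_sum, map_zsmul,
      FreeAbelianGroup.lift_apply_of, hh]
    rw [Fin.sum_univ_two, Fin.sum_univ_two]
    simp only [Fin.val_zero, Fin.val_one, pow_zero, pow_one, one_smul, neg_smul]
    abel
  | succ n ih =>
    obtain ⟨h, hh⟩ := ih
    have : ∀ σ : Simplex (n + 1) X, ∃ b, boundary (n + 1) X b =
        FreeAbelianGroup.of σ - h (boundary n X (FreeAbelianGroup.of σ)) := fun σ =>
      exists_boundary_eq hX _ (by rw [map_sub, hh, sub_self])
    choose k hk using this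
    have hk' : ∀ c, boundary (n + 1) X (FreeAbelianGroup.lift k c) = c - h (boundary n X c) :=
      fun c => DFunLike.congr_fun (f := (boundary (n + 1) X).comp (FreeAbelianGroup.lift k))
        (g := AddMonoidHom.id _ - h.comp (boundary n X))
        (FreeAbelianGroup.lift_ext _ _ fun σ => by simp [hk]) c
    exact ⟨FreeAbelianGroup.lift k, fun c => by rw [hk', boundary_boundary, map_zero, sub_zero]⟩

/-- A space in which every compact set lies in an embedded copy of a vector space has no
cohomology in positive degrees, with any coefficients. -/
theorem exists_coboundary_eq (hX : CompactsInCopiesOf E X) {T : Type*} [AddCommGroup T]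
    [Nonempty X] {n : ℕ} (φ : Cochain (n + 1) X T) (hφ : coboundary (n + 1) X T φ = 0) :
    ∃ ψ, coboundary n X T ψ = φ := by
  obtain ⟨h, hh⟩ := exists_boundary_section hX n
  refine ⟨fun σ => FreeAbelianGroup.lift φ (h (FreeAbelianGroup.of σ)), funext fun σ => ?_⟩
  have hφ' : ∀ c, FreeAbelianGroup.lift φ (boundary (n + 1) X c) = 0 := fun c => by
    rw [lift_boundary, hφ]
    exact DFunLike.congr_fun (f := FreeAbelianGroup.lift (0 : Cochain (n + 2) X T))
      (g := 0) (FreeAbelianGroup.lift_ext _ _ fun σ => by simp) c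
  obtain ⟨b, hb⟩ := exists_boundary_eq hX
    (FreeAbelianGroup.of σ - h (boundary n X (FreeAbelianGroup.of σ)))
    (by rw [map_sub, hh, sub_self])
  have := hφ' b
  rw [hb, map_sub, FreeAbelianGroup.lift_apply_of, sub_eq_zero, boundary_of] at this
  rw [this, coboundary_apply]
  simp only [map_sum, map_zsmul]

/-- In such a space a `0`-cocycle is constant. -/
theorem eq_of_coboundary_zero_eq_zero (hX : CompactsInCopiesOf E X) {T : Type*} [AddCommGroup T]
    (φ : Cochain 0 X T) (hφ : coboundary 0 X T φ = 0) (σ τ : Simplex 0 X) : φ σ = φ τ := by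
  obtain ⟨b, hb⟩ := exists_boundary_eq_sub hX σ τ
  have h := lift_boundary φ b
  rw [hb, hφ, map_sub, FreeAbelianGroup.lift_apply_of, FreeAbelianGroup.lift_apply_of,
    show FreeAbelianGroup.lift (0 : Cochain 1 X T) = 0 from
      FreeAbelianGroup.lift_ext _ _ fun σ => by simp] at h
  exact sub_eq_zero.1 h

end Acyclic

end SingularCohomology

/-! ### Finite index and polycyclic subgroups -/

namespace Subgroup

variable {G : Type*} [Group G]

/-- Relative finiteness of the index, in terms of finitely many left translates. -/
theorem relIndex_ne_zero_iff_exists_finite {K H : Subgroup G} :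
    K.relIndex H ≠ 0 ↔ ∃ S : Set G, S.Finite ∧ ∀ h ∈ H, ∃ s ∈ S, s⁻¹ * h ∈ K := by
  constructor
  · intro h
    have : Finite (H ⧸ K.subgroupOf H) := by
      have : (K.subgroupOf H).FiniteIndex := ⟨h⟩
      infer_instance
    refine ⟨Set.range fun q : H ⧸ K.subgroupOf H => (q.out : G), Set.finite_range _, fun g hg => ?_⟩
    have := QuotientGroup.eq.1 (QuotientGroup.out_eq' ((⟨g, hg⟩ : H) : H ⧸ K.subgroupOf H))
    exact ⟨_, ⟨((⟨g, hg⟩ : H) : H ⧸ K.subgroupOf H), rfl⟩, this⟩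
  · rintro ⟨S, hS, h⟩
    choose f hf hf' using fun x : H => h x x.2
    have : Finite S := hS
    have : Finite (H ⧸ K.subgroupOf H) := by
      refine Finite.of_injective (fun q => (⟨f q.out, hf _⟩ : S)) fun q q' e => ?_
      rw [← QuotientGroup.out_eq' q, ← QuotientGroup.out_eq' q']
      refine QuotientGroup.eq.2 (mem_subgroupOf.2 ?_)
      have e' : f q.out = f q'.out := congrArg Subtype.val e
      have := K.mul_mem (K.inv_mem (hf' q.out)) (e' ▸ hf' q'.out)
      simpa [mul_assoc] using this
    exact (finiteIndex_of_finite_quotient (H := K.subgroupOf H)).index_ne_zero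

theorem relIndex_ne_zero_of_le_left {A B K : Subgroup G} (hAB : A ≤ B) (h : A.relIndex K ≠ 0) :
    B.relIndex K ≠ 0 := fun h' => h (relIndex_eq_zero_of_le_left hAB h')

theorem relIndex_ne_zero_of_le_right {A K L : Subgroup G} (hKL : K ≤ L) (h : A.relIndex L ≠ 0) :
    A.relIndex K ≠ 0 := fun h' => h (relIndex_eq_zero_of_le_right hKL h')

theorem zpow_mul_mem_sup_zpowers {K : Subgroup G} {t : G}
    (ht : t ∈ normalizer (K : Set G)) {h : G} :
    h ∈ K ⊔ zpowers t ↔ ∃ j : ℤ, ∃ k ∈ K, t ^ j * k = h := by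
  have := coe_mul_of_left_le_normalizer_right (zpowers t) K ((zpowers_le).2 ht)
  rw [sup_comm, ← SetLike.mem_coe, this, Set.mem_mul]
  simp [mem_zpowers_iff]

/-- If `A` has finite index in `K`, then `⟨A, s⟩` with `s = tᵐ` has finite index in `⟨K, t⟩`. -/
theorem relIndex_sup_zpowers_pow_ne_zero {A K : Subgroup G} {t : G} {m : ℕ}
    (hm : 0 < m) (ht : t ∈ normalizer (K : Set G)) (hA : A.relIndex K ≠ 0) :
    (A ⊔ zpowers (t ^ m)).relIndex (K ⊔ zpowers t) ≠ 0 := by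
  obtain ⟨S, hS, h⟩ := relIndex_ne_zero_iff_exists_finite.1 hA
  refine relIndex_ne_zero_iff_exists_finite.2
    ⟨(fun p : ℕ × G => t ^ p.1 * p.2) '' ((Set.Iio m) ×ˢ S),
      ((Set.finite_Iio m).prod hS).image _, fun g hg => ?_⟩
  obtain ⟨j, k, hk, rfl⟩ := (zpow_mul_mem_sup_zpowers ht).1 hg
  have hm' : (m : ℤ) ≠ 0 := by exact_mod_cast hm.ne'
  obtain ⟨r, hr⟩ := Int.eq_ofNat_of_zero_le (Int.emod_nonneg j hm')
  have hrm : r < m := by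
    have := Int.emod_lt_of_pos j (by exact_mod_cast hm : (0 : ℤ) < m)
    omega
  -- write `t ^ j * k = t ^ r * k' * s ^ q` with `k'` a conjugate of `k`
  set s := t ^ m with hs
  set q := j / (m : ℤ)
  have hj : t ^ j = t ^ r * s ^ q := by
    rw [hs, ← zpow_natCast t r, ← zpow_natCast t m, ← zpow_mul, ← zpow_add]
    congr 1
    have := Int.emod_add_mul_ediv j m
    rw [hr] at this
    exact this.symm
  have hsq : s ^ q ∈ normalizer (K : Set G) := zpow_mem (pow_mem ht m) q
  have hk' : s ^ q * k * (s ^ q)⁻¹ ∈ K := (mem_normalizer_iff.1 hsq k).1 hk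
  obtain ⟨x, hx, hxk⟩ := h _ hk'
  refine ⟨_, ⟨(r, x), ⟨hrm, hx⟩, rfl⟩, ?_⟩
  have : (t ^ r * x)⁻¹ * (t ^ j * k) = x⁻¹ * (s ^ q * k * (s ^ q)⁻¹) * s ^ q := by
    rw [hj]; group
  rw [this]
  exact mul_mem (mem_sup_left hxk) (mem_sup_right (zpow_mem_zpowers s q))

/-- A finite-index subgroup of a finitely generated group `K` contains one that is normalized by
everything normalizing `K`: the intersection of the kernels of the finitely many homomorphisms from
`K` to a suitable finite group. -/
theorem exists_le_normalizer_le {K A : Subgroup G} (hK : K.FG) (hA : A.relIndex K ≠ 0) :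
    ∃ B ≤ A, B ≤ K ∧ B.relIndex K ≠ 0 ∧
      normalizer (K : Set G) ≤ normalizer (B : Set G) := by
  have hfi : (A.subgroupOf K).FiniteIndex := ⟨hA⟩
  let P := Equiv.Perm (K ⧸ A.subgroupOf K)
  have : Group.FG K := (Group.fg_iff_subgroup_fg K).2 hK
  have : Finite (K →* P) := by
    obtain ⟨S, hS⟩ := Group.fg_def.1 this
    refine Finite.of_injective (fun (f : K →* P) (s : S) => f s) fun f f' h => ?_
    exact MonoidHom.eq_of_eqOn_dense hS fun x hx => congrFun h ⟨x, hx⟩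
  let C : Subgroup K := ⨅ f : K →* P, f.ker
  have hC : C ≤ A.subgroupOf K := by
    refine (iInf_le _ (MulAction.toPermHom K (K ⧸ A.subgroupOf K))).trans fun x hx => ?_
    have := DFunLike.congr_fun (MonoidHom.mem_ker.1 hx) ((1 : K) : K ⧸ A.subgroupOf K)
    have h1 : ((x * 1 : K) : K ⧸ A.subgroupOf K) = ((1 : K) : K ⧸ A.subgroupOf K) := this
    simpa using QuotientGroup.eq.1 h1.symm
  have hCfi : C.index ≠ 0 :=
    index_iInf_ne_zero fun f => (finiteIndex_ker f).index_ne_zero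
  have hconj : ∀ t ∈ normalizer (K : Set G), ∀ x ∈ C.map K.subtype,
      t * x * t⁻¹ ∈ C.map K.subtype := by
    rintro t ht _ ⟨x, hx, rfl⟩
    have hmem : ∀ y : K, t * y * t⁻¹ ∈ K := fun y => (mem_normalizer_iff.1 ht y).1 y.2
    let c : K →* K :=
      { toFun := fun y => ⟨t * y * t⁻¹, hmem y⟩
        map_one' := by ext; simp
        map_mul' := fun y z => by ext; simp }
    refine ⟨c x, ?_, rfl⟩
    refine (mem_iInf).2 fun f => ?_
    exact (mem_iInf).1 hx (f.comp c)
  refine ⟨C.map K.subtype, ?_, ?_, ?_, fun t ht => mem_normalizer_iff.2 fun x =>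
    ⟨hconj t ht x, fun hx => ?_⟩⟩
  · rintro _ ⟨x, hx, rfl⟩
    exact hC hx
  · exact map_subtype_le C
  · rwa [relIndex, subgroupOf, comap_map_eq_self_of_injective K.subtype_injective]
  · have := hconj t⁻¹ (inv_mem ht) _ hx
    simpa [mul_assoc] using this

/-- Subgroups built from the trivial one by successively adjoining an element that normalizes what
has been built so far. -/
inductive IsPolycyclic : Subgroup G → Prop
  | bot : IsPolycyclic ⊥
  | sup_zpowers (K : Subgroup G) (t : G) : t ∈ normalizer (K : Set G) → IsPolycyclic K →
      IsPolycyclic (K ⊔ zpowers t)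

theorem IsPolycyclic.fg {K : Subgroup G} (hK : K.IsPolycyclic) : K.FG := by
  induction hK with
  | bot => exact FG.bot
  | sup_zpowers K t _ _ ih => exact ih.sup (zpowers_eq_closure t ▸ ⟨{t}, by simp⟩)

end Subgroup

/-! ### Almost invariant cochains -/

namespace SingularCohomology

open Subgroup

variable {G : Type*} [Group G] [TopologicalSpace G] [IsTopologicalGroup G]
variable {T : Type*} [AddCommGroup T] {n : ℕ}

/-- Right multiplication by `g`, as a continuous map. -/
def mulRightMap (g : G) : C(G, G) := ⟨(· * g), continuous_mul_const g⟩

@[simp]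
theorem mulRightMap_apply (g x : G) : mulRightMap g x = x * g := rfl

theorem mulRightMap_comp_comp {X : Type*} [TopologicalSpace X] (g h : G) (σ : C(X, G)) :
    (mulRightMap h).comp ((mulRightMap g).comp σ) = (mulRightMap (g * h)).comp σ := by
  ext x
  simp [mul_assoc]

theorem mulRightMap_one_comp {X : Type*} [TopologicalSpace X] (σ : C(X, G)) :
    (mulRightMap 1).comp σ = σ := by
  ext x
  simp

/-- The right translations that fix a singular cochain of the group `G`. -/
def cochainStabilizer (φ : Cochain n G T) : Subgroup G where
  carrier := {g | ∀ σ, φ ((mulRightMap g).comp σ) = φ σ}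
  mul_mem' {g h} hg hh σ := by rw [← mulRightMap_comp_comp, hh, hg]
  one_mem' σ := by rw [mulRightMap_one_comp]
  inv_mem' {g} hg σ := by
    rw [← hg, mulRightMap_comp_comp, inv_mul_cancel, mulRightMap_one_comp]

theorem mem_cochainStabilizer_iff_pullback_eq {φ : Cochain n G T} {g : G} :
    g ∈ cochainStabilizer φ ↔ cochainPullback n T (mulRightMap g) φ = φ :=
  (funext_iff (f := cochainPullback n T (mulRightMap g) φ)).symm

theorem cochainStabilizer_inf_le_sub (φ ψ : Cochain n G T) :
    cochainStabilizer φ ⊓ cochainStabilizer ψ ≤ cochainStabilizer (φ - ψ) := fun g hg σ => by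
  rw [Pi.sub_apply, Pi.sub_apply, hg.1, hg.2]

theorem cochainStabilizer_le_coboundary (φ : Cochain n G T) :
    cochainStabilizer φ ≤ cochainStabilizer (coboundary n G T φ) := fun g hg => by
  rw [mem_cochainStabilizer_iff_pullback_eq] at hg ⊢
  rw [← coboundary_cochainPullback, hg]

theorem le_cochainStabilizer_pullback {φ : Cochain n G T} {A : Subgroup G} {s : G}
    (hs : s ∈ normalizer (A : Set G)) (hA : A ≤ cochainStabilizer φ) :
    A ≤ cochainStabilizer (cochainPullback n T (mulRightMap s) φ) := fun g hg σ => by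
  change φ ((mulRightMap s).comp ((mulRightMap g).comp σ)) = φ ((mulRightMap s).comp σ)
  have h : s⁻¹ * g * s ∈ cochainStabilizer φ := hA ((mem_normalizer_iff''.1 hs g).1 hg)
  rw [← h ((mulRightMap s).comp σ), mulRightMap_comp_comp, mulRightMap_comp_comp]
  simp [mul_assoc]

/-- Discrete antiderivatives of functions on `ℤ`. -/
theorem exists_forall_add_one_eq (T : Type*) [AddCommGroup T] :
    ∃ F : (ℤ → T) → ℤ → T, ∀ a i, F a (i + 1) = F a i + a i := by
  refine ⟨fun a i => ∑ k ∈ Finset.Ico 0 i, a k - ∑ k ∈ Finset.Ico i 0, a k, fun a i => ?_⟩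
  simp only
  rcases le_or_gt 0 i with h | h
  · rw [← Finset.insert_Ico_right_eq_Ico_add_one h, Finset.sum_insert (by simp),
      Finset.Ico_eq_empty_of_le h, Finset.Ico_eq_empty_of_le (by omega : (0 : ℤ) ≤ i + 1)]
    simp [add_comm]
  · rw [← Finset.insert_Ico_add_one_left_eq_Ico h, Finset.sum_insert (by simp),
      Finset.Ico_eq_empty_of_le h.le, Finset.Ico_eq_empty_of_le (by omega : i + 1 ≤ (0 : ℤ))]
    simp

/-- If `s` normalizes `A` and has infinite order modulo `A`, the difference equation
`s θ - θ = χ` can be solved within `A`-invariant cochains: `⟨A, s⟩` acts freely on simplices, so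
one can sum along the `s`-orbits. -/
theorem exists_pullback_sub_eq {A : Subgroup G} {s : G} (hs : s ∈ normalizer (A : Set G))
    (hinf : ∀ j : ℤ, s ^ j ∈ A → j = 0) (χ : Cochain n G T) (hχ : A ≤ cochainStabilizer χ) :
    ∃ θ : Cochain n G T, A ≤ cochainStabilizer θ ∧
      cochainPullback n T (mulRightMap s) θ - θ = χ := by
  let M := A ⊔ zpowers s
  -- every `g` is `r g * s ^ j g * a` with `r g` a fixed representative of `gM` and `a ∈ A`
  let r : G → G := fun g => (g : G ⧸ M).out
  have hr : ∀ g, ∀ m ∈ M, r (g * m) = r g := fun g m hm => by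
    simp only [r, QuotientGroup.mk_mul_of_mem g hm]
  have hex : ∀ g, ∃ j : ℤ, ∃ a ∈ A, s ^ j * a = (r g)⁻¹ * g := fun g =>
    (zpow_mul_mem_sup_zpowers hs).1 (QuotientGroup.eq.1 (QuotientGroup.out_eq' (g : G ⧸ M)))
  choose j a ha hj using hex
  have huniq : ∀ (i k : ℤ), ∀ x ∈ A, ∀ y ∈ A, s ^ i * x = s ^ k * y → i = k := by
    intro i k x hx y hy h
    have : s ^ (i - k) = (s ^ (-k)) * (s ^ i * x) * x⁻¹ := by group
    rw [h] at this
    have h2 : s ^ (i - k) = y * x⁻¹ := by rw [this]; group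
    have := hinf (i - k) (h2 ▸ mul_mem hy (inv_mem hx))
    omega
  have hjA : ∀ g, ∀ x ∈ A, j (g * x) = j g := fun g x hx => by
    refine huniq _ _ (a (g * x)) (ha _) (a g * x) (mul_mem (ha _) hx) ?_
    rw [hj, hr g x (mem_sup_left hx), ← mul_assoc, ← mul_assoc, hj]
  have hjs : ∀ g, j (g * s) = j g + 1 := fun g => by
    refine huniq _ _ (a (g * s)) (ha _) (s⁻¹ * a g * s) ((mem_normalizer_iff''.1 hs _).1 (ha _)) ?_
    rw [hj, hr g s (mem_sup_right (mem_zpowers s)), ← mul_assoc, ← hj, zpow_add_one]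
    group
  obtain ⟨F, hF⟩ := exists_forall_add_one_eq T
  let b : Simplex n G → G := fun σ => σ (Classical.arbitrary _)
  let σ₀ : Simplex n G → Simplex n G := fun σ => (mulRightMap ((b σ)⁻¹ * r (b σ))).comp σ
  have hσ₀ : ∀ σ, ∀ m ∈ M, σ₀ ((mulRightMap m).comp σ) = σ₀ σ := fun σ m hm => by
    simp only [σ₀, mulRightMap_comp_comp]
    rw [show b ((mulRightMap m).comp σ) = b σ * m from rfl, hr _ m hm, mul_inv_rev, mul_assoc,
      mul_inv_cancel_left]
  refine ⟨fun σ => F (fun i => χ ((mulRightMap (s ^ i)).comp (σ₀ σ))) (j (b σ)),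
    fun x hx σ => ?_, funext fun σ => ?_⟩
  · simp only
    rw [hσ₀ σ x (mem_sup_left hx), show b ((mulRightMap x).comp σ) = b σ * x from rfl,
      hjA _ x hx]
  · change F (fun i => χ ((mulRightMap (s ^ i)).comp (σ₀ ((mulRightMap s).comp σ))))
      (j (b σ * s)) - F (fun i => χ ((mulRightMap (s ^ i)).comp (σ₀ σ))) (j (b σ)) = χ σ
    rw [hσ₀ σ s (mem_sup_right (mem_zpowers s)), hjs, hF, add_sub_cancel_left,
      ← hχ (inv_mem (ha (b σ))) σ]
    simp only [σ₀, mulRightMap_comp_comp]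
    rw [show (b σ)⁻¹ * r (b σ) * s ^ j (b σ) = (a (b σ))⁻¹ by
      rw [eq_mul_inv_of_mul_eq (hj (b σ))]; group]

/-- `K` acts on the singular cochains of `G` by right translation. The condition says that the
cochains fixed by some finite-index subgroup of `K` form a complex without cohomology in positive
degrees. -/
def AlmostInvariantAcyclic (K : Subgroup G) (T : Type*) [AddCommGroup T] : Prop :=
  ∀ (n : ℕ) (φ : Cochain (n + 1) G T), coboundary (n + 1) G T φ = 0 →
    (cochainStabilizer φ).relIndex K ≠ 0 →
    ∃ ψ : Cochain n G T, (cochainStabilizer ψ).relIndex K ≠ 0 ∧ coboundary n G T ψ = φ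

/-- Acyclicity passes from `K` to `⟨K, t⟩`. A cocycle has a primitive `ψ` that is almost invariant
under `K`, and a power `s` of `t` moves `ψ` by a cocycle; in positive degrees this is the coboundary
of an almost invariant `χ`, and subtracting from `ψ` the coboundary of a solution `θ` of
`s θ - θ = χ` makes it `s`-invariant. -/
theorem AlmostInvariantAcyclic.sup_zpowers [Finite T] {K : Subgroup G} {t : G}
    (hconst : ∀ c : Cochain 0 G T, coboundary 0 G T c = 0 → ∀ σ τ, c σ = c τ)
    (hfg : K.FG) (ht : t ∈ normalizer (K : Set G)) (hK : AlmostInvariantAcyclic K T) :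
    AlmostInvariantAcyclic (K ⊔ zpowers t) T := by
  intro n φ hφ hstab
  obtain ⟨ψ, hψ, rfl⟩ := hK n φ hφ (relIndex_ne_zero_of_le_right le_sup_left hstab)
  by_cases htK : ∃ m : ℕ, 0 < m ∧ t ^ m ∈ K
  · -- `K` has finite index in `⟨K, t⟩`
    obtain ⟨m, hm, hmK⟩ := htK
    refine ⟨ψ, ?_, rfl⟩
    have := relIndex_sup_zpowers_pow_ne_zero (m := m) hm ht hψ
    have h2 := relIndex_sup_zpowers_pow_ne_zero (m := m) hm ht (A := K) (by simp)
    rw [sup_eq_left.2 ((zpowers_le).2 hmK)] at h2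
    exact relIndex_ne_zero_trans hψ h2
  push Not at htK
  obtain ⟨m, hm, -, hms⟩ := exists_pow_mem_of_relIndex_ne_zero hstab
    (mem_sup_right (mem_zpowers t))
  set s := t ^ m with hs
  have hms : s ∈ cochainStabilizer (coboundary n G T ψ) := hms.1
  obtain ⟨A, hAψ, hAK, hA, hAn⟩ := exists_le_normalizer_le hfg hψ
  have hsA : s ∈ normalizer (A : Set G) := hAn (pow_mem ht m)
  have hinf : ∀ j : ℤ, s ^ j ∈ K → j = 0 := by
    intro j hj
    by_contra hj0
    refine htK (m * j.natAbs) (Nat.mul_pos hm (Int.natAbs_pos.2 hj0)) ?_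
    rw [pow_mul, ← hs]
    rcases Int.natAbs_eq j with h | h
    · rw [h, zpow_natCast] at hj; exact hj
    · rw [h, zpow_neg, inv_mem_iff, zpow_natCast] at hj; exact hj
  -- it suffices to make `ψ` invariant under a power of `s`
  suffices h : ∃ ψ' : Cochain n G T, coboundary n G T ψ' = coboundary n G T ψ ∧
      ∃ B : Subgroup G, B.relIndex K ≠ 0 ∧ B ≤ cochainStabilizer ψ' ∧
        ∃ k : ℕ, 0 < k ∧ s ^ k ∈ cochainStabilizer ψ' by
    obtain ⟨ψ', hψ', B, hB, hBψ, k, hk, hkψ⟩ := h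
    refine ⟨ψ', relIndex_ne_zero_of_le_left (sup_le hBψ ((zpowers_le).2 hkψ)) ?_, hψ'⟩
    rw [hs, ← pow_mul]
    exact relIndex_sup_zpowers_pow_ne_zero (Nat.mul_pos hm hk) ht hB
  have hd : coboundary n G T (cochainPullback n T (mulRightMap s) ψ - ψ) = 0 := by
    rw [map_sub, coboundary_cochainPullback,
      mem_cochainStabilizer_iff_pullback_eq.1 hms, sub_self]
  have hdA : A ≤ cochainStabilizer (cochainPullback n T (mulRightMap s) ψ - ψ) :=
    (le_inf (le_cochainStabilizer_pullback hsA hAψ) hAψ).trans (cochainStabilizer_inf_le_sub _ _)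
  cases n with
  | zero =>
    -- the difference is a constant `c`, so `s ^ |T|` fixes `ψ`
    let σ₁ : Simplex 0 G := .const _ 1
    set c := (cochainPullback 0 T (mulRightMap s) ψ - ψ) σ₁ with hc
    have hstep : ∀ σ, ψ ((mulRightMap s).comp σ) = ψ σ + c := fun σ => by
      rw [hc, hconst _ hd σ₁ σ]
      change _ = ψ σ + (ψ ((mulRightMap s).comp σ) - ψ σ)
      abel
    have hiter : ∀ (k : ℕ) σ, ψ ((mulRightMap (s ^ k)).comp σ) = ψ σ + k • c := by
      intro k
      induction k with
      | zero => intro σ; simp [mulRightMap_one_comp]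
      | succ k ih =>
        intro σ
        rw [pow_succ, ← mulRightMap_comp_comp, hstep, ih, succ_nsmul, add_assoc]
    refine ⟨ψ, rfl, A, hA, hAψ, Nat.card T, Nat.card_pos, fun σ => ?_⟩
    rw [hiter, card_nsmul_eq_zero', add_zero]
  | succ n =>
    obtain ⟨χ, hχ, hχψ⟩ := hK n _ hd (relIndex_ne_zero_of_le_left hdA hA)
    obtain ⟨B, hBA, hBK, hB, hBn⟩ := exists_le_normalizer_le hfg (relIndex_inf_ne_zero hχ hA)
    have hsB : s ∈ normalizer (B : Set G) := hBn (pow_mem ht m)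
    obtain ⟨θ, hθ, hθχ⟩ := exists_pullback_sub_eq hsB (fun j hj => hinf j (hBK hj)) χ
      (hBA.trans inf_le_left)
    refine ⟨ψ - coboundary n G T θ, ?_, B, hB, ?_, 1, one_pos, ?_⟩
    · rw [map_sub, coboundary_coboundary, sub_zero]
    · exact (le_inf ((hBA.trans inf_le_right).trans hAψ)
        (hθ.trans (cochainStabilizer_le_coboundary θ))).trans (cochainStabilizer_inf_le_sub _ _)
    · rw [pow_one, mem_cochainStabilizer_iff_pullback_eq, map_sub, ← coboundary_cochainPullback,
        sub_eq_iff_eq_add.1 hθχ, map_add, hχψ]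
      abel

theorem almostInvariantAcyclic_of_isPolycyclic [Finite T] {E : Type*} [NormedAddCommGroup E]
    [NormedSpace ℝ E] (hG : CompactsInCopiesOf E G) {K : Subgroup G} (hK : K.IsPolycyclic) :
    AlmostInvariantAcyclic K T := by
  induction hK with
  | bot =>
    intro n φ hφ _
    obtain ⟨ψ, hψ⟩ := exists_coboundary_eq hG φ hφ
    exact ⟨ψ, by simp, hψ⟩
  | sup_zpowers K t ht hK ih =>
    exact ih.sup_zpowers (eq_of_coboundary_zero_eq_zero hG) hK.fg ht

end SingularCohomology

/-! ### Cocompact discrete subgroups of nilpotent groups -/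

namespace Subgroup

open scoped commutatorElement Pointwise

section Nilpotent

variable {G : Type*} [Group G]

/-- A subgroup between consecutive terms `γᵢ₊₁ ≤ B ≤ γᵢ` of the lower central series of `L` is
normalized by `L`. -/
theorem le_normalizer_of_lowerCentralSeries_le {L B : Subgroup G} {i : ℕ}
    (h₁ : L.lowerCentralSeries (i + 1) ≤ B) (h₂ : B ≤ L.lowerCentralSeries i) :
    L ≤ normalizer (B : Set G) := by
  have key : ∀ g ∈ L, ∀ b ∈ B, g * b * g⁻¹ ∈ B := fun g hg b hb => by
    have : ⁅b, g⁆ ∈ B := h₁ (commutator_mem_commutator (h₂ hb) hg)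
    rw [show g * b * g⁻¹ = ⁅b, g⁆⁻¹ * b by rw [commutatorElement_def]; group]
    exact mul_mem (inv_mem this) hb
  refine fun g hg => mem_normalizer_iff.2 fun b => ⟨key g hg b, fun hb => ?_⟩
  simpa [mul_assoc] using key g⁻¹ (inv_mem hg) _ hb

/-- If `L` is generated by a finite set, each `γᵢ` is generated modulo `γᵢ₊₁` by the finite set of
iterated commutators of the generators. -/
theorem exists_finite_lowerCentralSeries_eq {L : Subgroup G} (hL : L.FG) (i : ℕ) :
    ∃ S : Set G, S.Finite ∧ L.lowerCentralSeries i = closure S ⊔ L.lowerCentralSeries (i + 1) := by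
  obtain ⟨S₀, hS₀⟩ := hL
  induction i with
  | zero =>
    refine ⟨S₀, S₀.finite_toSet, ?_⟩
    rw [lowerCentralSeries_zero, hS₀, eq_comm, sup_eq_left]
    exact lowerCentralSeries_le_self L 1
  | succ i ih =>
    obtain ⟨S, hS, hSi⟩ := ih
    have hSL : ∀ x ∈ S, x ∈ L.lowerCentralSeries i := fun x hx =>
      hSi ▸ mem_sup_left (subset_closure hx)
    have hS₀L : ∀ y ∈ S₀, y ∈ L := fun y hy => hS₀ ▸ subset_closure hy
    refine ⟨Set.image2 (fun x y => ⁅x, y⁆) S S₀, hS.image2 _ S₀.finite_toSet, ?_⟩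
    set N := closure (Set.image2 (fun x y => ⁅x, y⁆) S S₀) ⊔ L.lowerCentralSeries (i + 1 + 1)
      with hN
    have hNle : N ≤ L.lowerCentralSeries (i + 1) := by
      refine sup_le ((closure_le _).2 ?_) (L.lowerCentralSeries_antitone (Nat.le_succ _))
      rintro _ ⟨x, hx, y, hy, rfl⟩
      exact commutator_mem_commutator (hSL x hx) (hS₀L y hy)
    have hnorm := le_normalizer_of_lowerCentralSeries_le (le_sup_right (a := closure _)) hNle
    have hconj : ∀ g ∈ L, ∀ b ∈ N, g * b * g⁻¹ ∈ N := fun g hg b hb =>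
      (mem_normalizer_iff.1 (hnorm hg) b).1 hb
    have hiL : L.lowerCentralSeries i ≤ L := lowerCentralSeries_le_self L i
    refine le_antisymm ((commutator_le).2 fun x hx y hy => ?_) hNle
    have h₁ : ∀ x ∈ S, ∀ y ∈ L, ⁅x, y⁆ ∈ N := by
      intro x hx y hy
      rw [← hS₀] at hy
      induction hy using closure_induction with
      | mem y hy => exact mem_sup_left (subset_closure ⟨x, hx, y, hy, rfl⟩)
      | one => simp
      | mul y z hy _ ihy ihz =>
        rw [show ⁅x, y * z⁆ = ⁅x, y⁆ * (y * ⁅x, z⁆ * y⁻¹) by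
          simp only [commutatorElement_def]; group]
        exact mul_mem ihy (hconj y (hS₀ ▸ hy) _ ihz)
      | inv y hy ihy =>
        rw [show ⁅x, y⁻¹⁆ = y⁻¹ * ⁅x, y⁆⁻¹ * y⁻¹⁻¹ by simp only [commutatorElement_def]; group]
        exact hconj _ (inv_mem (hS₀ ▸ hy)) _ (inv_mem ihy)
    have hx' : x ∈ closure (S ∪ L.lowerCentralSeries (i + 1)) := by
      rwa [closure_union, closure_eq, ← hSi]
    have hcl : closure (S ∪ L.lowerCentralSeries (i + 1)) ≤ L := by
      rw [closure_union, closure_eq, ← hSi]; exact hiL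
    clear hx
    induction hx' using closure_induction with
    | mem x hx =>
      rcases hx with hx | hx
      · exact h₁ x hx y hy
      · exact mem_sup_right (commutator_mem_commutator hx hy)
    | one => simp
    | mul x z hx _ ihx ihz =>
      rw [show ⁅x * z, y⁆ = (x * ⁅z, y⁆ * x⁻¹) * ⁅x, y⁆ by
        simp only [commutatorElement_def]; group]
      exact mul_mem (hconj x (hcl hx) _ ihz) ihx
    | inv x hx ihx =>
      rw [show ⁅x⁻¹, y⁆ = x⁻¹ * ⁅x, y⁆⁻¹ * x⁻¹⁻¹ by simp only [commutatorElement_def]; group]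
      exact hconj _ (inv_mem (hcl hx)) _ (inv_mem ihx)

theorem isPolycyclic_of_fg_of_isNilpotent [Group.IsNilpotent G] {L : Subgroup G} (hL : L.FG) :
    L.IsPolycyclic := by
  obtain ⟨n, hn⟩ := (nilpotent_iff_lowerCentralSeries (G := G)).1 inferInstance
  have hbot : L.lowerCentralSeries n = ⊥ := le_bot_iff.1 (hn ▸ lowerCentralSeries_mono n le_top)
  suffices h : ∀ i ≤ n, (L.lowerCentralSeries i).IsPolycyclic from h 0 (Nat.zero_le n)
  intro i hi
  induction hi using Nat.decreasingInduction with
  | self => exact hbot ▸ IsPolycyclic.bot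
  | of_succ i _ ih =>
    obtain ⟨S, hS, hSi⟩ := exists_finite_lowerCentralSeries_eq hL i
    rw [hSi]
    have hSle : S ⊆ L.lowerCentralSeries i := fun x hx => by
      rw [hSi]; exact mem_sup_left (subset_closure hx)
    clear hSi
    induction S, hS using Set.Finite.induction_on with
    | empty => simpa using ih
    | @insert t S _ _ ihS =>
      have hS' : S ⊆ L.lowerCentralSeries i := (Set.subset_insert _ _).trans hSle
      rw [Set.insert_eq, closure_union, ← zpowers_eq_closure, sup_assoc, sup_comm]
      refine .sup_zpowers _ t ?_ (ihS hS')
      exact le_normalizer_of_lowerCentralSeries_le le_sup_right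
        (sup_le ((closure_le _).2 hS') (L.lowerCentralSeries_antitone (Nat.le_succ _)))
        (lowerCentralSeries_le_self L i (hSle (Set.mem_insert _ _)))

end Nilpotent

/-- A locally compact group with compact quotient `G ⧸ L` is covered by the translates under `L` of
the interior of a compact set. -/
theorem exists_isCompact_interior_mul {G : Type*} [Group G] [TopologicalSpace G]
    [IsTopologicalGroup G] [LocallyCompactSpace G] (L : Subgroup G) [CompactSpace (G ⧸ L)] :
    ∃ C : Set G, IsCompact C ∧ ∀ g : G, ∃ c ∈ interior C, ∃ l ∈ L, c * l = g := by
  choose K hK hKn using fun x : G ⧸ L => exists_compact_mem_nhds x.out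
  obtain ⟨t, ht⟩ := CompactSpace.elim_nhds_subcover
    (fun x : G ⧸ L => (QuotientGroup.mk '' interior (K x) : Set (G ⧸ L))) fun x => by
      refine (QuotientGroup.isOpenMap_coe _ isOpen_interior).mem_nhds ?_
      exact ⟨x.out, mem_interior_iff_mem_nhds.2 (hKn x), QuotientGroup.out_eq' x⟩
  refine ⟨⋃ x ∈ t, K x, t.finite_toSet.isCompact_biUnion fun x _ => hK x, fun g => ?_⟩
  have hg : (g : G ⧸ L) ∈ ⋃ x ∈ t, (QuotientGroup.mk '' interior (K x) : Set (G ⧸ L)) :=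
    ht ▸ Set.mem_univ _
  simp only [Set.mem_iUnion] at hg
  obtain ⟨x, hx, c, hc, hcg⟩ := hg
  refine ⟨c, interior_mono (Set.subset_biUnion_of_mem (u := K) hx) hc, c⁻¹ * g,
    QuotientGroup.eq.1 hcg, mul_inv_cancel_left c g⟩

/-- A discrete cocompact subgroup of a connected locally compact group is generated by the finitely
many elements that move a compact set `C` with `int C · L = G` so as to meet itself. -/
theorem fg_of_discrete_of_cocompact {G : Type*} [Group G] [TopologicalSpace G]
    [IsTopologicalGroup G] [T2Space G] [LocallyCompactSpace G] [ConnectedSpace G]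
    (L : Subgroup G) [DiscreteTopology L] [CompactSpace (G ⧸ L)] : L.FG := by
  obtain ⟨C, hC, hCL⟩ := exists_isCompact_interior_mul L
  have hfin : ((C⁻¹ * C) ∩ L : Set G).Finite := by
    have hLc : IsClosed (L : Set G) := Subgroup.isClosed_of_discrete
    have hd : DiscreteTopology (((C⁻¹ * C) ∩ L : Set G)) :=
      DiscreteTopology.of_subset (s := (L : Set G)) inferInstance Set.inter_subset_right
    exact ((hC.inv.mul hC).inter_right hLc).finite ⟨hd⟩
  let L₁ : Subgroup G := closure ((C⁻¹ * C) ∩ L)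
  have hL₁ : L₁ ≤ L := (closure_le _).2 Set.inter_subset_right
  have key : ∀ c ∈ C, ∀ c' ∈ C, ∀ l ∈ L, ∀ a ∈ L₁, c * l = c' * a → l ∈ L₁ := by
    intro c hc c' hc' l hl a ha h
    have h1 : c'⁻¹ * c = a * l⁻¹ := by
      rw [inv_mul_eq_iff_eq_mul, ← mul_assoc, ← h, mul_inv_cancel_right]
    have h2 : a * l⁻¹ ∈ L₁ := subset_closure ⟨h1 ▸ Set.mul_mem_mul (Set.inv_mem_inv.2 hc') hc,
      mul_mem (hL₁ ha) (inv_mem hl)⟩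
    have h3 := mul_mem (inv_mem h2) ha
    simpa using h3
  let V : Set G := interior C * L₁
  have hV : IsClopen V := by
    refine ⟨⟨isOpen_iff_mem_nhds.2 fun g hg => ?_⟩, isOpen_interior.mul_right⟩
    obtain ⟨c, hc, l, hl, rfl⟩ := hCL g
    have hl₁ : l ∉ L₁ := fun h => hg (Set.mul_mem_mul hc h)
    refine Filter.mem_of_superset ((isOpen_interior.mul_right (t := {l})).mem_nhds
      (Set.mul_mem_mul hc (Set.mem_singleton l))) ?_
    rintro _ ⟨c₁, hc₁, _, rfl, rfl⟩ ⟨c₂, hc₂, a, ha, h⟩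
    exact hl₁ (key c₁ (interior_subset hc₁) c₂ (interior_subset hc₂) _ hl a ha h.symm)
  obtain ⟨c, hc, -⟩ := hCL 1
  have hV' : V = Set.univ := hV.eq_univ ⟨c * 1, Set.mul_mem_mul hc L₁.one_mem⟩
  suffices h : L = L₁ from (fg_iff L).2 ⟨_, h.symm, hfin⟩
  refine le_antisymm (fun l hl => ?_) hL₁
  obtain ⟨c', hc', a, ha, h⟩ : c * l ∈ V := hV' ▸ Set.mem_univ _
  exact key c (interior_subset hc) c' (interior_subset hc') l hl a ha h.symm

end Subgroup

/-! ### Finite covers of quotients by discrete subgroups -/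

namespace SingularCohomology

open Subgroup

section Covering

variable {X Y : Type*} [TopologicalSpace X] [TopologicalSpace Y] {n : ℕ}

/-- Singular simplices lift through surjective covering maps, as `Δⁿ` is contractible. -/
theorem exists_comp_eq_of_isCoveringMap {p : C(X, Y)} (hp : IsCoveringMap p)
    (hs : Function.Surjective p) (σ : Simplex n Y) : ∃ τ : Simplex n X, p.comp τ = σ := by
  have : ContractibleSpace (stdSimplex ℝ (Fin (n + 1))) :=
    (convex_stdSimplex ℝ (Fin (n + 1))).contractibleSpace ⟨_, (Classical.arbitrary
      (stdSimplex ℝ (Fin (n + 1)))).2⟩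
  obtain ⟨v, ⟨H⟩⟩ := id_nullhomotopic (stdSimplex ℝ (Fin (n + 1)))
  obtain ⟨x, hx⟩ := hs (σ v)
  let K : C(unitInterval × stdSimplex ℝ (Fin (n + 1)), Y) := σ.comp H.symm.toContinuousMap
  have hK : ∀ a, K (0, a) = p (ContinuousMap.const _ x a) := fun a => by
    simp [K, hx]
  refine ⟨(hp.liftHomotopy K (.const _ x) hK).comp ⟨fun a => (1, a), by fun_prop⟩, ?_⟩
  ext a
  have := congrFun (hp.liftHomotopy_lifts K (.const _ x) hK) (1, a)
  refine this.trans ?_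
  simp [K]

/-- A cochain on a group that is invariant under a discrete subgroup descends to the quotient. -/
theorem exists_cochainPullback_mk_eq {G T : Type*} [Group G] [TopologicalSpace G]
    [IsTopologicalGroup G] [AddCommGroup T] (L : Subgroup G) [DiscreteTopology L]
    (ψ : Cochain n G T) (hψ : L ≤ cochainStabilizer ψ) :
    ∃ χ : Cochain n (G ⧸ L) T,
      cochainPullback n T ⟨((↑) : G → G ⧸ L), continuous_quotient_mk'⟩ χ = ψ := by
  have hL := L.isQuotientCoveringMap ⟨inferInstance⟩
  have hp := hL.isCoveringMap
  let p : C(G, G ⧸ L) := ⟨((↑) : G → G ⧸ L), continuous_quotient_mk'⟩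
  choose lift hlift using
    exists_comp_eq_of_isCoveringMap (p := p) hp QuotientGroup.mk_surjective (n := n)
  refine ⟨fun σ => ψ (lift σ), funext fun σ => ?_⟩
  change ψ (lift (p.comp σ)) = ψ σ
  let v : stdSimplex ℝ (Fin (n + 1)) := Classical.arbitrary _
  have hv : (lift (p.comp σ) v : G ⧸ L) = σ v := DFunLike.congr_fun (hlift (p.comp σ)) v
  rw [← hψ (QuotientGroup.eq.1 hv) (lift (p.comp σ))]
  congr 1
  refine DFunLike.coe_injective (hp.eq_of_comp_eq (ContinuousMap.continuous _)
    (ContinuousMap.continuous _) ?_ v (by simp))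
  funext x
  have hx : (lift (p.comp σ) x : G ⧸ L) = σ x := DFunLike.congr_fun (hlift (p.comp σ)) x
  rw [Function.comp_apply, Function.comp_apply, ← hx]
  exact QuotientGroup.mk_mul_of_mem _ (QuotientGroup.eq.1 hv)

theorem cochainPullback_injective {T : Type*} [AddCommGroup T] {p : C(X, Y)}
    (hp : IsCoveringMap p) (hs : Function.Surjective p) :
    Function.Injective (cochainPullback n T p) := fun χ χ' h => funext fun σ => by
  obtain ⟨τ, rfl⟩ := exists_comp_eq_of_isCoveringMap hp hs σ
  exact congrFun h τ

/-- Cochains on a disjoint union are families of cochains. -/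
theorem exists_cochainPullback_sigmaMk_eq {T ι : Type*} [AddCommGroup T]
    (χ : ι → Cochain n X T) : ∃ Ψ : Cochain n (Σ _ : ι, X) T,
      ∀ i, cochainPullback n T (ContinuousMap.sigmaMk i) Ψ = χ i := by
  choose i g h using fun τ : C(stdSimplex ℝ (Fin (n + 1)), Σ _ : ι, X) => τ.exists_lift_sigma
  refine ⟨fun τ => χ (i τ) (g τ), fun k => funext fun σ => ?_⟩
  change χ (i ((ContinuousMap.sigmaMk k).comp σ)) (g ((ContinuousMap.sigmaMk k).comp σ)) = χ k σ
  have h' := h ((ContinuousMap.sigmaMk k).comp σ)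
  generalize i ((ContinuousMap.sigmaMk k).comp σ) = k' at h'
  generalize g ((ContinuousMap.sigmaMk k).comp σ) = σ' at h'
  have hk : k = k' := congrArg Sigma.fst (DFunLike.congr_fun h' (Classical.arbitrary _))
  subst hk
  congr 1
  ext x
  have := DFunLike.congr_fun h' x
  exact (sigma_mk_injective this).symm

theorem cochain_ext_sigma {T ι : Type*} {χ χ' : Cochain n (Σ _ : ι, X) T}
    (h : ∀ i (σ : Simplex n X), χ ((ContinuousMap.sigmaMk i).comp σ) =
      χ' ((ContinuousMap.sigmaMk i).comp σ)) : χ = χ' := funext fun τ => by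
  obtain ⟨i, σ, rfl⟩ := ContinuousMap.exists_lift_sigma τ
  exact h i σ

theorem pullback_mk_eq_zero {T : Type*} [AddCommGroup T] (f : C(X, Y)) (φ : cocycles (n + 1) Y T)
    (ψ : Cochain n X T) (h : coboundary n X T ψ = cochainPullback (n + 1) T f φ.1) :
    pullback (n + 1) T f (QuotientAddGroup.mk φ) = 0 :=
  (QuotientAddGroup.eq_zero_iff _).2 ⟨ψ, h⟩

end Covering

section Quotient

variable {G : Type u} [Group G] [TopologicalSpace G] [IsTopologicalGroup G]

/-- The right translations of `G` that fix a map on `G`. -/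
def mapStabilizer {Y : Type*} (h : G → Y) : Subgroup G where
  carrier := {g | ∀ x, h (x * g) = h x}
  mul_mem' {a b} ha hb x := by rw [← mul_assoc, hb, ha]
  one_mem' x := by rw [mul_one]
  inv_mem' {a} ha x := by rw [← ha (x * a⁻¹), inv_mul_cancel_right]

/-- A map from `G` to a finite cover of `G ⧸ L` that lifts the projection is invariant under a
finite-index subgroup of `L`, since `L` permutes the lifts and these are determined by one value. -/
theorem relIndex_mapStabilizer_ne_zero [ConnectedSpace G] {L : Subgroup G} {N : Type*}
    [TopologicalSpace N] {q : C(N, G ⧸ L)} (hq : IsFiniteCover q) (h : C(G, N))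
    (hh : ∀ g, q (h g) = g) : (mapStabilizer h).relIndex L ≠ 0 := by
  have hF : Finite (q ⁻¹' {((1 : G) : G ⧸ L)}) := hq.finite_fiber _
  have hL : ∀ l : L, q (h l) = ((1 : G) : G ⧸ L) := fun l => by
    rw [hh]; exact QuotientGroup.eq.2 (by simp)
  let f : L → q ⁻¹' {((1 : G) : G ⧸ L)} := fun l => ⟨h l, hL l⟩
  refine relIndex_ne_zero_iff_exists_finite.2 ⟨Set.range fun y : Set.range f => (y.2.choose : G),
    Set.finite_range _, fun l hl => ?_⟩
  let y : Set.range f := ⟨f ⟨l, hl⟩, Set.mem_range_self _⟩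
  refine ⟨_, ⟨y, rfl⟩, ?_⟩
  have hy : h (y.2.choose : G) = h l := congrArg Subtype.val y.2.choose_spec
  set s := y.2.choose
  have : (fun x => h (x * s)) = fun x => h (x * l) := by
    refine hq.isCoveringMap.eq_of_comp_eq (by fun_prop) (by fun_prop) (funext fun x => ?_) 1
      (by simpa using hy)
    simp only [Function.comp_apply, hh]
    rw [QuotientGroup.mk_mul_of_mem _ hl, QuotientGroup.mk_mul_of_mem _ s.2]
  intro x
  have := congrFun this (x * (s : G)⁻¹)
  simp only [inv_mul_cancel_right] at this
  change h (x * ((s : G)⁻¹ * l)) = h x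
  rw [this, mul_assoc]

theorem compactSpace_quotient_of_relIndex_ne_zero [LocallyCompactSpace G] {L M : Subgroup G}
    [CompactSpace (G ⧸ L)] (hM : M.relIndex L ≠ 0) : CompactSpace (G ⧸ M) := by
  obtain ⟨C, hC, hCL⟩ := exists_isCompact_interior_mul L
  obtain ⟨S, hS, hSL⟩ := relIndex_ne_zero_iff_exists_finite.1 hM
  have hc : IsCompact (((↑) : G → G ⧸ M) '' ((fun p : G × G => p.1 * p.2) '' (C ×ˢ S))) :=
    ((hC.prod hS.isCompact).image continuous_mul).image continuous_quotient_mk'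
  refine ⟨?_⟩
  convert hc
  refine (Set.eq_univ_of_forall fun x => ?_).symm
  obtain ⟨g, rfl⟩ := QuotientGroup.mk_surjective x
  obtain ⟨c, hc, l, hl, rfl⟩ := hCL g
  obtain ⟨s, hs, hsl⟩ := hSL l hl
  exact ⟨_, ⟨(c, s), ⟨interior_subset hc, hs⟩, rfl⟩, QuotientGroup.eq.2 (by
    simpa [mul_assoc] using hsl)⟩

/-- If the almost invariant cochains of `G` are acyclic, then `G ⧸ L` satisfies condition (*). Let
`N` be a finite cover of `G ⧸ L`, with finite fiber `F` over the base point. The pullbacks of a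
cocycle on `N` along the lifts `G → N` of the projection have almost invariant primitives, all
invariant under one subgroup `M` of finite index in `L`. They descend to `G ⧸ M`, and `F × (G ⧸ M)`
is a finite cover of `N` on which the cocycle becomes a coboundary. -/
theorem conditionStar_of_almostInvariantAcyclic [T2Space G] [LocallyCompactSpace G]
    [SimplyConnectedSpace G] [LocallyPathConnectedSpace G] (L : Subgroup G) [DiscreteTopology L]
    [CompactSpace (G ⧸ L)]
    (hL : ∀ (T : Type v) [AddCommGroup T] [Finite T], AlmostInvariantAcyclic L T) :
    ConditionStar.{u, v, w} (G ⧸ L) := by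
  intro i hi T _ _ N _ q hq x
  obtain ⟨n, rfl⟩ : ∃ n, i = n + 1 := ⟨i - 1, by omega⟩
  obtain ⟨φ, rfl⟩ := QuotientAddGroup.mk_surjective x
  have hLc : IsClosed (L : Set G) := Subgroup.isClosed_of_discrete
  have hN : T2Space N := by
    refine ⟨fun x y hxy => ?_⟩
    by_cases h : q x = q y
    · exact hq.isCoveringMap.isSeparatedMap x y h hxy
    · exact separated_by_continuous q.continuous h
  let π : C(G, G ⧸ L) := ⟨((↑) : G → G ⧸ L), continuous_quotient_mk'⟩
  have hπ : IsCoveringMap π := (L.isQuotientCoveringMap ⟨inferInstance⟩).isCoveringMap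
  -- the lifts of `π` to `N`, one for each point `f` over the base point
  let F := q ⁻¹' {((1 : G) : G ⧸ L)}
  have : Finite F := hq.finite_fiber _
  have hlift : ∀ (g : G) (y : N), q y = π g → ∃ P : C(G, N), P g = y ∧ ∀ x, q (P x) = x := by
    intro g y hy
    obtain ⟨P, ⟨hP, hP'⟩, -⟩ := hq.isCoveringMap.existsUnique_continuousMap_lifts π g y hy
    exact ⟨P, hP, fun x => congrFun hP' x⟩
  choose P hP1 hPq using fun f : F => hlift 1 f f.2
  have hfill : ∀ f, ∃ ψ : Cochain n G T, (cochainStabilizer ψ).relIndex L ≠ 0 ∧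
      coboundary n G T ψ = cochainPullback (n + 1) T (P f) φ.1 := by
    intro f
    refine hL T n _ ?_ ?_
    · rw [coboundary_cochainPullback, show coboundary (n + 1) N T φ.1 = 0 from φ.2, map_zero]
    · refine relIndex_ne_zero_of_le_left (fun g hg σ => ?_)
        (relIndex_mapStabilizer_ne_zero hq (P f) (hPq f))
      exact congrArg φ.1 (ContinuousMap.ext fun x => hg (σ x))
  choose ψ hψ hψφ using hfill
  -- the subgroup whose quotient carries the cover of `N`
  let M : Subgroup G := L ⊓ ⨅ f, (mapStabilizer (P f) ⊓ cochainStabilizer (ψ f))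
  have hML : M ≤ L := inf_le_left
  have hMP : ∀ f, M ≤ mapStabilizer (P f) := fun f =>
    inf_le_right.trans ((iInf_le _ f).trans inf_le_left)
  have hMψ : ∀ f, M ≤ cochainStabilizer (ψ f) := fun f =>
    inf_le_right.trans ((iInf_le _ f).trans inf_le_right)
  have hM : M.relIndex L ≠ 0 := relIndex_inf_ne_zero (by simp) (relIndex_iInf_ne_zero fun f =>
    relIndex_inf_ne_zero (relIndex_mapStabilizer_ne_zero hq (P f) (hPq f)) (hψ f))
  have hMd : DiscreteTopology M :=
    DiscreteTopology.of_subset (s := (L : Set G)) (t := (M : Set G)) inferInstance hML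
  have hMc : IsClosed (M : Set G) := Subgroup.isClosed_of_discrete
  have : CompactSpace (G ⧸ M) := compactSpace_quotient_of_relIndex_ne_zero hM
  let πM : C(G, G ⧸ M) := ⟨((↑) : G → G ⧸ M), continuous_quotient_mk'⟩
  have hπM : IsCoveringMap πM := (M.isQuotientCoveringMap ⟨inferInstance⟩).isCoveringMap
  have hπMs : Function.Surjective πM := QuotientGroup.mk_surjective
  let Pb : F → C(G ⧸ M, N) := fun f => ⟨Quotient.lift (P f) fun a b hab => by
    have := hMP f (QuotientGroup.leftRel_apply.1 hab) a
    rw [mul_inv_cancel_left] at this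
    exact this.symm, (P f).continuous.quotient_lift _⟩
  have hPlocal : ∀ f, IsLocalHomeomorph (P f) := fun f =>
    IsLocalHomeomorph.of_comp (g := q) (by
      rw [show q ∘ P f = π from funext (hPq f)]; exact hπ.isLocalHomeomorph)
      hq.isCoveringMap.isLocalHomeomorph (P f).continuous
  have hPblocal : ∀ f, IsLocalHomeomorph (Pb f) := fun f => by
    have := IsLocalHomeomorphOn.of_comp_right (f := πM) (g := Pb f) (s := Set.univ)
      (hPlocal f).isLocalHomeomorphOn hπM.isLocalHomeomorph.isLocalHomeomorphOn
    rwa [Set.image_univ, hπMs.range_eq, ← isLocalHomeomorph_iff_isLocalHomeomorphOn_univ] at this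
  let p : C(Σ _ : F, G ⧸ M, N) := ⟨fun y => Pb y.1 y.2, continuous_sigma fun f => (Pb f).continuous⟩
  have hplocal : IsLocalHomeomorph p := by
    rw [isLocalHomeomorph_iff_isLocalHomeomorphOn_univ]
    rintro ⟨f, y⟩ -
    have := IsLocalHomeomorphOn.of_comp_right (f := Sigma.mk f) (g := p) (s := Set.univ)
      (hPblocal f).isLocalHomeomorphOn
      Topology.IsOpenEmbedding.sigmaMk.isLocalHomeomorph.isLocalHomeomorphOn
    exact this _ ⟨y, trivial, rfl⟩
  have hp : IsCoveringMap p := isLocalHomeomorph_iff_isCoveringMap.1 hplocal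
  -- the fibers are discrete closed subsets of a compact space
  have hpfin : ∀ y, (p ⁻¹' {y}).Finite := fun y =>
    (isClosed_singleton.preimage p.continuous).isCompact.finite ⟨(hp y).discreteTopology_fiber⟩
  have hps : Function.Surjective p := by
    intro y
    obtain ⟨g, hg⟩ := QuotientGroup.mk_surjective (q y)
    obtain ⟨Q, hQ, hQq⟩ := hlift g y hg.symm
    have hQP : P ⟨Q 1, hQq 1⟩ = Q := DFunLike.coe_injective
      (hq.isCoveringMap.eq_of_comp_eq (P _).continuous Q.continuous
        (funext fun x => (hPq _ x).trans (hQq x).symm) 1 (hP1 _))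
    exact ⟨⟨⟨Q 1, hQq 1⟩, πM g⟩, (DFunLike.congr_fun hQP g).trans hQ⟩
  -- the cover has finite fibers over `N`, so it can be moved to the universe of `N`
  have hsmall : Small.{w} (Σ _ : F, G ⧸ M) := by
    have (y : N) : Small.{w} {x // p x = y} :=
      have : Finite {x // p x = y} := hpfin y
      inferInstance
    exact small_map (Equiv.sigmaFiberEquiv p).symm
  let e : Shrink.{w} (Σ _ : F, G ⧸ M) ≃ₜ (Σ _ : F, G ⧸ M) := (Shrink.homeomorph _).symm
  -- the primitives descend to `G ⧸ M`
  choose χ hχ using fun f => exists_cochainPullback_mk_eq M (ψ f) (hMψ f)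
  have hχφ : ∀ f, coboundary n (G ⧸ M) T (χ f) = cochainPullback (n + 1) T (Pb f) φ.1 := by
    intro f
    refine cochainPullback_injective hπM hπMs ?_
    rw [← coboundary_cochainPullback, hχ, hψφ]
    rfl
  obtain ⟨Ψ, hΨ⟩ := exists_cochainPullback_sigmaMk_eq χ
  have hΨφ : coboundary n _ T Ψ = cochainPullback (n + 1) T p φ.1 := by
    refine cochain_ext_sigma fun f σ => ?_
    have : cochainPullback (n + 1) T (ContinuousMap.sigmaMk f) (coboundary n _ T Ψ) =
        cochainPullback (n + 1) T (Pb f) φ.1 := by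
      rw [← coboundary_cochainPullback, hΨ, hχφ]
    exact congrFun this σ
  refine ⟨Shrink.{w} (Σ _ : F, G ⧸ M), inferInstance, p.comp ⟨e, e.continuous⟩,
    ⟨hp.comp_homeomorph e, hps.comp e.surjective, fun y => ?_⟩, ?_⟩
  · exact Set.Finite.preimage (f := e) e.injective.injOn (hpfin y)
  · refine pullback_mk_eq_zero _ φ (cochainPullback n T ⟨e, e.continuous⟩ Ψ) ?_
    rw [coboundary_cochainPullback, hΨφ]
    rfl

end Quotient

end SingularCohomology

/-! ### Square roots in nilpotent groups -/

namespace Subgroup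

open scoped commutatorElement

section UniqueRoots

variable {G : Type*} [Group G]

/-- If squares detect membership in the center, then they detect membership in each term of the
upper central series, inside the next one. -/
theorem mem_upperCentralSeries_of_mul_self_mem (hZ : ∀ x : G, x * x ∈ center G → x ∈ center G)
    (i : ℕ) : ∀ x ∈ upperCentralSeries G (i + 2), x * x ∈ upperCentralSeries G (i + 1) →
      x ∈ upperCentralSeries G (i + 1) := by
  induction i with
  | zero =>
    intro x _ hx
    rw [zero_add, upperCentralSeries_one] at hx ⊢
    exact hZ x hx
  | succ i ih =>
    intro x hx hxx y
    -- `⁅x, y⁆² ≡ ⁅x², y⁆` modulo the next lower term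
    have hc : ⁅x, y⁆ ∈ upperCentralSeries G (i + 2) := hx y
    refine ih _ hc ?_
    have h : ⁅x, y⁆ * ⁅x, y⁆ = ⁅⁅x, y⁆, x⁆ * ⁅x * x, y⁆ := by
      simp only [commutatorElement_def]; group
    rw [h]
    exact mul_mem (hc x) (hxx y)

theorem mul_inv_mem_center_of_mul_self_eq [Group.IsNilpotent G]
    (hZ : ∀ x : G, x * x ∈ center G → x ∈ center G) {x y : G} (hxy : x * x = y * y) :
    x * y⁻¹ ∈ center G := by
  obtain ⟨n, hn⟩ := Group.IsNilpotent.nilpotent G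
  suffices h : ∀ i ≤ n, x * y⁻¹ ∈ upperCentralSeries G (i + 1) by
    rw [← upperCentralSeries_one]; exact h 0 (Nat.zero_le n)
  intro i hi
  induction hi using Nat.decreasingInduction with
  | self => exact upperCentralSeries_mono G (Nat.le_succ n) (hn ▸ mem_top _)
  | of_succ i _ ih =>
    refine mem_upperCentralSeries_of_mul_self_mem hZ i _ ih ?_
    -- with `z = x y⁻¹`, the equality `x² = y²` reads `z² ⁅z⁻¹, y⁆ = 1`
    have h : x * y⁻¹ * (x * y⁻¹) = x * x * (y * y)⁻¹ * ⁅(x * y⁻¹)⁻¹, y⁆⁻¹ := by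
      simp only [commutatorElement_def]; group
    rw [h, hxy, mul_inv_cancel, one_mul]
    exact inv_mem (inv_mem ih y)

end UniqueRoots

section LowerCentral

/-- The last nontrivial term of the lower central series is generated by the images of continuous
homomorphisms from the group to itself. -/
theorem lowerCentralSeries_le_of_forall_monoidHom {G : Type*} [Group G] [TopologicalSpace G]
    [IsTopologicalGroup G] {n : ℕ} (hn : (⊤ : Subgroup G).lowerCentralSeries (n + 1) = ⊥)
    (C : Subgroup G) (hC : ∀ f : G →* G, Continuous f →
      (∀ y, f y ∈ (⊤ : Subgroup G).lowerCentralSeries n) → ∀ y, f y ∈ C) :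
    (⊤ : Subgroup G).lowerCentralSeries n ≤ C := by
  cases n with
  | zero => exact fun y _ => hC (MonoidHom.id G) continuous_id (fun _ => mem_top _) y
  | succ k =>
    refine commutator_le.2 fun x hx y _ => ?_
    have hcomm : ∀ z w, ⁅x, z⁆ * w = w * ⁅x, z⁆ := fun z w => by
      have h1 : ⁅x, z⁆ ∈ (⊤ : Subgroup G).lowerCentralSeries (k + 1) :=
        commutator_mem_commutator hx (mem_top z)
      have h2 : ⁅⁅x, z⁆, w⁆ ∈ (⊤ : Subgroup G).lowerCentralSeries (k + 1 + 1) :=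
        commutator_mem_commutator h1 (mem_top w)
      rw [hn, mem_bot, commutatorElement_eq_one_iff_mul_comm] at h2
      exact h2
    let f : G →* G := MonoidHom.mk' (fun y => ⁅x, y⁆) fun y z => by
      rw [show ⁅x, y * z⁆ = ⁅x, y⁆ * (y * (⁅x, z⁆ * y⁻¹)) by
        simp only [commutatorElement_def]; group, hcomm z y⁻¹,
        mul_inv_cancel_left]
    refine hC f ?_ (fun y => commutator_mem_commutator hx (mem_top y)) y
    change Continuous fun y => x * y * x⁻¹ * y⁻¹
    fun_prop

theorem commute_of_mem_lowerCentralSeries {G : Type*} [Group G] {n : ℕ}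
    (hn : (⊤ : Subgroup G).lowerCentralSeries (n + 1) = ⊥) {a : G}
    (ha : a ∈ (⊤ : Subgroup G).lowerCentralSeries n) (x : G) : Commute a x := by
  have h : ⁅a, x⁆ ∈ (⊤ : Subgroup G).lowerCentralSeries (n + 1) :=
    commutator_mem_commutator ha (mem_top x)
  rw [hn, mem_bot, commutatorElement_eq_one_iff_mul_comm] at h
  exact h

/-- In a group generated by squares, the last nontrivial term of the lower central series consists
of squares of its own elements. -/
theorem exists_mul_self_eq_of_mem_lowerCentralSeries {G : Type*} [Group G] [TopologicalSpace G]
    [IsTopologicalGroup G] {n : ℕ} (hn : (⊤ : Subgroup G).lowerCentralSeries (n + 1) = ⊥)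
    (hG : closure (Set.range fun x : G => x * x) = ⊤) {c : G}
    (hc : c ∈ (⊤ : Subgroup G).lowerCentralSeries n) :
    ∃ d ∈ (⊤ : Subgroup G).lowerCentralSeries n, d * d = c := by
  let C : Subgroup G :=
    { carrier := {c | ∃ d ∈ (⊤ : Subgroup G).lowerCentralSeries n, d * d = c}
      mul_mem' := by
        rintro _ _ ⟨a, ha, rfl⟩ ⟨b, hb, rfl⟩
        exact ⟨a * b, mul_mem ha hb, (commute_of_mem_lowerCentralSeries hn hb a).mul_mul_mul_comm a b⟩
      one_mem' := ⟨1, one_mem _, one_mul 1⟩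
      inv_mem' := by
        rintro _ ⟨a, ha, rfl⟩
        exact ⟨a⁻¹, inv_mem ha, (mul_inv_rev a a).symm⟩ }
  refine lowerCentralSeries_le_of_forall_monoidHom hn C (fun f _ hf y => ?_) hc
  have : closure (Set.range fun x : G => x * x) ≤ C.comap f := by
    refine (closure_le _).2 ?_
    rintro _ ⟨b, rfl⟩
    exact ⟨f b, hf b, (map_mul f b b).symm⟩
  exact this (hG ▸ mem_top y)

theorem lowerCentralSeries_quotient_eq_bot {G : Type*} [Group G] (n : ℕ) :
    (⊤ : Subgroup (G ⧸ (⊤ : Subgroup G).lowerCentralSeries n)).lowerCentralSeries n = ⊥ := by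
  have h := map_lowerCentralSeries (⊤ : Subgroup G)
    (QuotientGroup.mk' ((⊤ : Subgroup G).lowerCentralSeries n)) n
  rw [map_top_of_surjective _ (QuotientGroup.mk'_surjective _)] at h
  rw [← h, QuotientGroup.map_mk'_self]

/-- A nilpotent topological group generated by squares consists of squares. -/
theorem exists_mul_self_eq (n : ℕ) : ∀ (G : Type u) [Group G] [TopologicalSpace G]
    [IsTopologicalGroup G], (⊤ : Subgroup G).lowerCentralSeries n = ⊥ →
    closure (Set.range fun x : G => x * x) = ⊤ → ∀ g : G, ∃ x, x * x = g := by
  induction n with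
  | zero =>
    intro G _ _ _ h _ g
    have : g ∈ (⊥ : Subgroup G) := h ▸ mem_top g
    exact ⟨1, by rw [mem_bot.1 this, one_mul]⟩
  | succ n ih =>
    intro G _ _ _ hn hG g
    let A := (⊤ : Subgroup G).lowerCentralSeries n
    have hQ : closure (Set.range fun x : G ⧸ A => x * x) = ⊤ := by
      have h : closure (Set.range fun x : G => x * x) ≤
          (closure (Set.range fun x : G ⧸ A => x * x)).comap (QuotientGroup.mk' A) := by
        refine (closure_le _).2 ?_
        rintro _ ⟨x, rfl⟩
        exact subset_closure ⟨(x : G ⧸ A), rfl⟩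
      refine top_le_iff.1 fun x _ => ?_
      obtain ⟨x, rfl⟩ := QuotientGroup.mk_surjective x
      exact h (hG ▸ mem_top x)
    obtain ⟨x, hx⟩ := ih (G ⧸ A) (lowerCentralSeries_quotient_eq_bot n) hQ g
    obtain ⟨x, rfl⟩ := QuotientGroup.mk_surjective x
    obtain ⟨d, hd, hdx⟩ := exists_mul_self_eq_of_mem_lowerCentralSeries hn hG (QuotientGroup.eq.1 hx)
    refine ⟨x * d, ?_⟩
    rw [(commute_of_mem_lowerCentralSeries hn hd x).mul_mul_mul_comm x d, hdx]
    exact mul_inv_cancel_left _ _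

end LowerCentral

section Roots

open Filter Topology

/-- In a connected nilpotent topological group with unique square roots, if the iterated square
roots of the elements near `1` converge to `1`, so do those of every element. On the last
nontrivial term of the lower central series this holds because the elements in question form a
subgroup; the rest is induction on the nilpotency class. -/
theorem tendsto_iterate_root (n : ℕ) : ∀ (G : Type u) [Group G] [TopologicalSpace G]
    [IsTopologicalGroup G] [ConnectedSpace G], (⊤ : Subgroup G).lowerCentralSeries n = ⊥ →
    ∀ r : G → G, (∀ x, r x * r x = x) → (∀ x, r (x * x) = x) →
    ∀ D ∈ 𝓝 (1 : G), (∀ x ∈ D, Tendsto (fun k => r^[k] x) atTop (𝓝 1)) →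
    ∀ x, Tendsto (fun k => r^[k] x) atTop (𝓝 1) := by
  induction n with
  | zero =>
    intro G _ _ _ _ h r _ _ D hD hr x
    have : x ∈ (⊥ : Subgroup G) := h ▸ mem_top x
    rw [mem_bot.1 this]
    exact hr 1 (mem_of_mem_nhds hD)
  | succ n ih =>
    intro G _ _ _ _ hn r hr hr' D hD hrD x
    let A := (⊤ : Subgroup G).lowerCentralSeries n
    have hsq : closure (Set.range fun x : G => x * x) = ⊤ := top_le_iff.1 fun x _ =>
      subset_closure ⟨r x, hr x⟩
    have hrA : ∀ a ∈ A, r a ∈ A := fun a ha => by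
      obtain ⟨d, hd, rfl⟩ := exists_mul_self_eq_of_mem_lowerCentralSeries hn hsq ha
      rwa [hr']
    have hrkA : ∀ k, ∀ a ∈ A, r^[k] a ∈ A := fun k => by
      induction k with
      | zero => exact fun a ha => ha
      | succ k ihk => intro a ha; exact ihk _ (hrA a ha)
    have hmul : ∀ x, ∀ a ∈ A, r (x * a) = r x * r a := fun x a ha => by
      have := (commute_of_mem_lowerCentralSeries hn (hrA a ha) (r x)).mul_mul_mul_comm (r x) (r a)
      rw [hr, hr] at this
      exact (congrArg r this).symm.trans (hr' _)
    have hmulk : ∀ k x, ∀ a ∈ A, r^[k] (x * a) = r^[k] x * r^[k] a := fun k => by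
      induction k with
      | zero => exact fun x a _ => rfl
      | succ k ihk =>
        intro x a ha
        rw [Function.iterate_succ_apply, hmul x a ha, ihk _ _ (hrA a ha)]
        rfl
    have hone : r 1 = 1 := by simpa using hr' 1
    have hinv : ∀ a, r a⁻¹ = (r a)⁻¹ := fun a => by
      rw [← hr' (r a)⁻¹, ← mul_inv_rev, hr]
    have hinvk : ∀ k a, r^[k] a⁻¹ = (r^[k] a)⁻¹ := fun k => by
      induction k with
      | zero => exact fun a => rfl
      | succ k ihk => intro a; rw [Function.iterate_succ_apply, hinv, ihk]; rfl
    -- the claim on `A`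
    let C : Subgroup G :=
      { carrier := {a | a ∈ A ∧ Tendsto (fun k => r^[k] a) atTop (𝓝 1)}
        mul_mem' := by
          rintro a b ⟨ha, ha'⟩ ⟨hb, hb'⟩
          refine ⟨mul_mem ha hb, ?_⟩
          simp only [hmulk _ a b hb]
          simpa using ha'.mul hb'
        one_mem' := ⟨one_mem _, by
          simpa only [Function.iterate_fixed hone] using tendsto_const_nhds⟩
        inv_mem' := by
          rintro a ⟨ha, ha'⟩
          refine ⟨inv_mem ha, ?_⟩
          simp only [hinvk]
          simpa using ha'.inv }
    have hAC : A ≤ C := by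
      refine lowerCentralSeries_le_of_forall_monoidHom hn C fun f hf hfA y => ?_
      have hopen : IsOpen (C.comap f : Set G) := by
        refine Subgroup.isOpen_of_mem_nhds _ (g := 1) ?_
        have : f ⁻¹' D ∈ 𝓝 (1 : G) := hf.continuousAt.preimage_mem_nhds (by rwa [map_one])
        exact mem_of_superset this fun z hz => ⟨hfA z, hrD _ hz⟩
      have huniv : (C.comap f : Set G) = Set.univ :=
        IsClopen.eq_univ ⟨Subgroup.isClosed_of_isOpen _ hopen, hopen⟩ ⟨1, one_mem _⟩
      exact (huniv ▸ Set.mem_univ y : y ∈ (C.comap f : Set G))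
    -- the claim on `G ⧸ A`
    let rQ : G ⧸ A → G ⧸ A := Quotient.map' r fun x y hxy => by
      rw [QuotientGroup.leftRel_apply] at hxy ⊢
      rw [← mul_inv_cancel_left x y, hmul x _ hxy, inv_mul_cancel_left]
      exact hrA _ hxy
    have hrQk : ∀ k (x : G), rQ^[k] (x : G ⧸ A) = (r^[k] x : G) := fun k => by
      induction k with
      | zero => exact fun x => rfl
      | succ k ihk => intro x; exact ihk (r x)
    have : ConnectedSpace (G ⧸ A) :=
      inferInstanceAs (ConnectedSpace (Quotient (QuotientGroup.leftRel A)))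
    have hπ : Tendsto ((↑) : G → G ⧸ A) (𝓝 1) (𝓝 1) :=
      continuous_quotient_mk'.tendsto' _ _ rfl
    have hQ := ih (G ⧸ A) (lowerCentralSeries_quotient_eq_bot n) rQ
      (fun x => by
        obtain ⟨x, rfl⟩ := QuotientGroup.mk_surjective x
        exact congrArg ((↑) : G → G ⧸ A) (hr x))
      (fun x => by
        obtain ⟨x, rfl⟩ := QuotientGroup.mk_surjective x
        exact congrArg ((↑) : G → G ⧸ A) (hr' x))
      (((↑) : G → G ⧸ A) '' D) (QuotientGroup.isOpenMap_coe.image_mem_nhds hD) (by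
        rintro _ ⟨y, hy, rfl⟩
        simp only [hrQk]
        exact hπ.comp (hrD y hy)) x
    simp only [hrQk] at hQ
    obtain ⟨k, hk⟩ := (hQ.eventually (QuotientGroup.isOpenMap_coe.image_mem_nhds hD)).exists
    obtain ⟨y, hy, hyk⟩ := hk
    have ha : y⁻¹ * r^[k] x ∈ A := QuotientGroup.eq.1 hyk
    rw [← tendsto_add_atTop_iff_nat k]
    have heq : ∀ m, r^[m + k] x = r^[m] y * r^[m] (y⁻¹ * r^[k] x) := fun m => by
      rw [← hmulk m y _ ha, mul_inv_cancel_left, Function.iterate_add_apply]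
    simp only [heq]
    simpa using (hrD y hy).mul (hAC ha).2

end Roots

end Subgroup

/-! ### Nilpotent groups in which squaring is a local homeomorphism -/

section SquareRoots

open Filter Topology Subgroup

variable {G : Type u} [Group G] [TopologicalSpace G] [IsTopologicalGroup G]

/-- In a connected group whose squaring map is a local homeomorphism, the square roots of a central
element are central: conjugation moves them inside a discrete fiber. -/
theorem mem_center_of_mul_self_mem_center [T2Space G] [ConnectedSpace G]
    (hloc : IsLocalHomeomorph fun x : G => x * x) {x : G} (hx : x * x ∈ center G) :
    x ∈ center G := by
  rw [mem_center_iff] at hx ⊢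
  intro g
  have hc : ∀ a : G, a * x * a⁻¹ * (a * x * a⁻¹) = x * x := fun a => by
    rw [show a * x * a⁻¹ * (a * x * a⁻¹) = a * (x * x) * a⁻¹ by group, hx a, mul_inv_cancel_right]
  have h := (T2Space.isSeparatedMap fun x : G => x * x).const_of_comp hloc.isLocallyInjective
    (g := fun a : G => a * x * a⁻¹) (by fun_prop) (fun a b => by rw [hc, hc]) g 1
  simp only [one_mul, inv_one, mul_one] at h
  exact mul_inv_eq_iff_eq_mul.1 h

/-- In a simply connected nilpotent group, if squaring is a local homeomorphism, then it is a
homeomorphism: it is surjective, and a covering map with the central elements of order at most two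
as deck group, hence injective because its target is simply connected. -/
theorem exists_homeomorph_mul_self [T2Space G] [SimplyConnectedSpace G]
    [LocallyPathConnectedSpace G] [Group.IsNilpotent G]
    (hloc : IsLocalHomeomorph fun x : G => x * x) : ∃ s : G ≃ₜ G, ∀ x, s x = x * x := by
  have hZ : ∀ x : G, x * x ∈ center G → x ∈ center G := fun x =>
    mem_center_of_mul_self_mem_center hloc
  have hsurj : Function.Surjective fun x : G => x * x := by
    obtain ⟨n, hn⟩ := (Subgroup.nilpotent_iff_lowerCentralSeries (G := G)).1 inferInstance
    refine exists_mul_self_eq n G hn ?_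
    have hopen : IsOpen (Subgroup.closure (Set.range fun x : G => x * x) : Set G) :=
      Subgroup.isOpen_of_mem_nhds _ (g := 1) (mem_of_superset
        (hloc.isOpenMap.isOpen_range.mem_nhds ⟨1, mul_one 1⟩) Subgroup.subset_closure)
    exact SetLike.coe_injective
      (IsClopen.eq_univ ⟨Subgroup.isClosed_of_isOpen _ hopen, hopen⟩ ⟨1, one_mem _⟩)
  let A : Subgroup G :=
    { carrier := {x | x ∈ center G ∧ x * x = 1}
      mul_mem' := by
        rintro a b ⟨ha, ha'⟩ ⟨hb, hb'⟩
        refine ⟨mul_mem ha hb, ?_⟩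
        have hab : Commute b a := mem_center_iff.1 ha b
        rw [hab.mul_mul_mul_comm, ha', hb', mul_one]
      one_mem' := ⟨one_mem _, mul_one 1⟩
      inv_mem' := by
        rintro a ⟨ha, ha'⟩
        exact ⟨inv_mem ha, by rw [← mul_inv_rev, ha', inv_one]⟩ }
  have hA : IsDiscrete (A : Set G) := by
    -- squaring is locally injective and constant on `A`
    refine (hloc.isLocalHomeomorphOn (s := (A : Set G))).isDiscrete_of_image ?_
    refine (Set.subsingleton_singleton (a := (1 : G))).anti ?_ |>.isDiscrete
    rintro _ ⟨x, hx, rfl⟩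
    exact hx.2
  have hsq : ∀ x y : G, y * x⁻¹ ∈ center G → y * y = y * x⁻¹ * (y * x⁻¹) * (x * x) := by
    intro x y hz
    have hxz : Commute x (y * x⁻¹) := mem_center_iff.1 hz x
    rw [hxz.symm.mul_mul_mul_comm, inv_mul_cancel_right]
  have hcov : IsCoveringMap fun x : G => x * x := by
    refine ((hloc.isOpenMap.isQuotientMap hloc.continuous
      hsurj).isQuotientCoveringMap_of_subgroup A hA
        fun {x y} => ⟨fun h => ?_, fun h => ?_⟩).isCoveringMap
    · have hz : y * x⁻¹ ∈ center G := mul_inv_mem_center_of_mul_self_eq hZ h.symm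
      refine ⟨hz, ?_⟩
      have hxy := hsq x y hz
      rw [← show x * x = y * y from h] at hxy
      exact mul_eq_right.1 hxy.symm
    · obtain ⟨hz, hz'⟩ := h
      have hxy := hsq x y hz
      rw [hz', one_mul] at hxy
      exact hxy.symm
  obtain ⟨R, ⟨hR1, hR⟩, -⟩ :=
    hcov.existsUnique_continuousMap_lifts (ContinuousMap.id G) 1 1 (mul_one 1)
  have hR' : ∀ x, R x * R x = x := fun x => congrFun hR x
  have hleft : (fun x => R (x * x)) = id :=
    hcov.eq_of_comp_eq (by fun_prop) continuous_id
      (funext fun x => by simp [hR']) 1 (by simp [hR1])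
  exact ⟨⟨⟨fun x => x * x, R, fun x => congrFun hleft x, hR'⟩, hloc.continuous, R.continuous⟩,
    fun x => rfl⟩

/-- Iterated squaring spreads a chart around `1` over the whole group, if squaring is expanding in
that chart: conversely, iterated square roots contract every compact set into the chart. -/
theorem compactsInCopiesOf_of_expanding [T2Space G] [SimplyConnectedSpace G]
    [LocallyPathConnectedSpace G] [Group.IsNilpotent G] {E : Type*} [NormedAddCommGroup E]
    [NormedSpace ℝ E] (hloc : IsLocalHomeomorph fun x : G => x * x)
    (e : OpenPartialHomeomorph G E) (h1 : 1 ∈ e.source)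
    (hexp : ∀ᶠ v in 𝓝 (e 1), 3 / 2 * ‖v - e 1‖ ≤ ‖e (e.symm v * e.symm v) - e 1‖) :
    SingularCohomology.CompactsInCopiesOf E G := by
  obtain ⟨s, hs⟩ := exists_homeomorph_mul_self hloc
  set c := e 1 with hc
  have hsymm : e.symm c = 1 := e.left_inv h1
  have hct : c ∈ e.target := e.map_source h1
  have hr1 : s.symm 1 = 1 := by rw [Homeomorph.symm_apply_eq, hs, mul_one]
  -- on a small ball, square roots contract towards the center
  obtain ⟨ε, hε, hball⟩ : ∃ ε > 0, ∀ u ∈ Metric.ball c ε, u ∈ e.target ∧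
      s.symm (e.symm u) ∈ e.source ∧ ‖e (s.symm (e.symm u)) - c‖ ≤ 2 / 3 * ‖u - c‖ := by
    have hcont : ContinuousAt (fun u => s.symm (e.symm u)) c :=
      s.symm.continuous.continuousAt.comp (e.continuousAt_symm hct)
    have hval : s.symm (e.symm c) = 1 := by rw [hsymm, hr1]
    have hsrc : ∀ᶠ u in 𝓝 c, s.symm (e.symm u) ∈ e.source :=
      hcont.eventually (p := (· ∈ e.source)) (by
        simp only [hval]; exact e.open_source.mem_nhds h1)
    have hcont' : Tendsto (fun u => e (s.symm (e.symm u))) (𝓝 c) (𝓝 c) := by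
      have : ContinuousAt e (s.symm (e.symm c)) := by rw [hval]; exact e.continuousAt h1
      have := this.comp (f := fun u => s.symm (e.symm u)) hcont
      rw [ContinuousAt, Function.comp_apply, hval] at this
      exact this
    have hev : ∀ᶠ u in 𝓝 c, u ∈ e.target ∧ s.symm (e.symm u) ∈ e.source ∧
        ‖e (s.symm (e.symm u)) - c‖ ≤ 2 / 3 * ‖u - c‖ := by
      filter_upwards [e.open_target.mem_nhds hct, hsrc, hcont'.eventually hexp] with u hu hu' h
      refine ⟨hu, hu', ?_⟩
      rw [e.left_inv hu', ← hs, s.apply_symm_apply, e.right_inv hu] at h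
      linarith
    obtain ⟨ε, hε, h⟩ := Metric.eventually_nhds_iff_ball.1 hev
    exact ⟨ε, hε, h⟩
  let B : Set G := e.symm '' Metric.ball c ε
  have hBt : Metric.ball c ε ⊆ e.target := fun u hu => (hball u hu).1
  have hBopen : IsOpen B := e.symm.isOpen_image_of_subset_source Metric.isOpen_ball hBt
  have hB1 : (1 : G) ∈ B := ⟨c, Metric.mem_ball_self hε, hsymm⟩
  have hiter : ∀ (k : ℕ), ∀ u ∈ Metric.ball c ε, ∃ w ∈ Metric.ball c ε,
      s.symm^[k] (e.symm u) = e.symm w ∧ ‖w - c‖ ≤ (2 / 3) ^ k * ‖u - c‖ := by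
    intro k u hu
    induction k with
    | zero => exact ⟨u, hu, rfl, by simp⟩
    | succ k ih =>
      obtain ⟨w, hw, hwu, hwn⟩ := ih
      obtain ⟨-, hw2, hw3⟩ := hball w hw
      refine ⟨e (s.symm (e.symm w)), ?_, ?_, ?_⟩
      · rw [mem_ball_iff_norm] at hw ⊢
        have := norm_nonneg (w - c)
        linarith
      · rw [Function.iterate_succ_apply', hwu, e.left_inv hw2]
      · rw [pow_succ]
        linarith
  have hmaps : ∀ k, ∀ x ∈ B, s.symm^[k] x ∈ B := by
    rintro k _ ⟨u, hu, rfl⟩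
    obtain ⟨w, hw, hwu, -⟩ := hiter k u hu
    exact ⟨w, hw, hwu.symm⟩
  have htend : ∀ x ∈ B, Tendsto (fun k => s.symm^[k] x) atTop (𝓝 1) := by
    rintro _ ⟨u, hu, rfl⟩
    choose w hw hwu hwn using fun k => hiter k u hu
    have hwc : Tendsto w atTop (𝓝 c) := by
      rw [tendsto_iff_norm_sub_tendsto_zero]
      refine squeeze_zero (fun k => norm_nonneg _) hwn ?_
      simpa using (tendsto_pow_atTop_nhds_zero_of_lt_one (r := (2 / 3 : ℝ)) (by norm_num)
        (by norm_num)).mul_const ‖u - c‖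
    simp only [hwu]
    have := (e.continuousAt_symm hct).tendsto
    rw [hsymm] at this
    exact this.comp hwc
  -- hence every point is eventually moved into `B` by taking square roots
  have hall : ∀ x, Tendsto (fun k => s.symm^[k] x) atTop (𝓝 1) := by
    obtain ⟨n, hn⟩ := (Subgroup.nilpotent_iff_lowerCentralSeries (G := G)).1 inferInstance
    refine tendsto_iterate_root n G hn s.symm (fun x => ?_) (fun x => ?_) B (hBopen.mem_nhds hB1)
      htend
    · rw [← hs, s.apply_symm_apply]
    · rw [← hs, s.symm_apply_apply]
  intro K hK
  have hcontk : ∀ k, Continuous (s.symm^[k]) := fun k => s.symm.continuous.iterate k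
  obtain ⟨k, hk⟩ : ∃ k, ∀ x ∈ K, s.symm^[k] x ∈ B := by
    obtain ⟨k, hk⟩ := hK.elim_directed_cover (fun k => s.symm^[k] ⁻¹' B)
      (fun k => hBopen.preimage (hcontk k)) (fun x _ => Set.mem_iUnion.2
        ((hall x).eventually (hBopen.mem_nhds hB1)).exists)
      (directed_of_isDirected_le fun i j hij x hx => by
        obtain ⟨m, rfl⟩ := Nat.exists_eq_add_of_le' hij
        change s.symm^[m + i] x ∈ B
        rw [Function.iterate_add_apply]
        exact hmaps m _ hx)
    exact ⟨k, hk⟩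
  let b : OpenPartialHomeomorph E E := OpenPartialHomeomorph.univBall c ε
  have hbt : b.target = Metric.ball c ε := OpenPartialHomeomorph.univBall_target c hε
  have hemb : IsOpenEmbedding (b.trans e.symm) := by
    refine OpenPartialHomeomorph.isOpenEmbedding _ ?_
    rw [OpenPartialHomeomorph.trans_source, OpenPartialHomeomorph.univBall_source]
    refine Set.eq_univ_of_forall fun u => ⟨trivial, hBt ?_⟩
    rw [← hbt]
    exact b.map_source (by rw [OpenPartialHomeomorph.univBall_source]; trivial)
  have hsk : IsEmbedding (s^[k]) := by
    clear hk
    induction k with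
    | zero => exact IsEmbedding.id
    | succ k ih => exact ih.comp s.isEmbedding
  refine ⟨⟨s^[k] ∘ b.trans e.symm, hsk.continuous.comp hemb.continuous⟩,
    hsk.comp hemb.isEmbedding, fun x hx => ?_⟩
  obtain ⟨u, hu, hux⟩ := hk x hx
  refine ⟨b.symm u, ?_⟩
  have hbu : b (b.symm u) = u := b.right_inv (hbt ▸ hu)
  change s^[k] (e.symm (b (b.symm u))) = x
  rw [hbu, hux]
  exact Function.LeftInverse.iterate s.apply_symm_apply k x

end SquareRoots

/-! ### Nilpotent Lie groups -/

section LieGroups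

open Filter Topology commutatorElement

variable {E : Type e} [NormedAddCommGroup E]
variable {G : Type u} [TopologicalSpace G] [ChartedSpace E G] [Group G]

theorem chartAt_symm_chartAt_one : (chartAt E (1 : G)).symm (chartAt E (1 : G) 1) = 1 :=
  (chartAt E (1 : G)).left_inv (mem_chart_source E 1)

theorem tendsto_chartAt_one_symm :
    Tendsto (chartAt E (1 : G)).symm (𝓝 (chartAt E (1 : G) 1)) (𝓝 1) := by
  have h := (chartAt E (1 : G)).continuousAt_symm (mem_chart_target E (1 : G))
  rwa [ContinuousAt, chartAt_symm_chartAt_one] at h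

variable [NormedSpace ℝ E]

/-- The self-map `f` of `G` fixes `1`, and has derivative `A` there. The derivative is read in the
preferred chart around `1`, so that it is an endomorphism of the model space `E`. -/
structure HasDerivAtOne (f : G → G) (A : E →L[ℝ] E) : Prop where
  map_one : f 1 = 1
  continuousAt : ContinuousAt f 1
  hasStrictFDerivAt : HasStrictFDerivAt
    (fun u => chartAt E (1 : G) (f ((chartAt E (1 : G)).symm u))) A (chartAt E (1 : G) 1)

namespace HasDerivAtOne

variable {f g : G → G} {A B : E →L[ℝ] E}

theorem tendsto (hf : HasDerivAtOne f A) :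
    Tendsto (fun u => f ((chartAt E (1 : G)).symm u)) (𝓝 (chartAt E (1 : G) 1)) (𝓝 1) := by
  have h := hf.continuousAt.tendsto.comp (tendsto_chartAt_one_symm (E := E))
  rwa [hf.map_one] at h

theorem eventually_symm_chartAt (hf : HasDerivAtOne f A) :
    ∀ᶠ u in 𝓝 (chartAt E (1 : G) 1),
      (chartAt E (1 : G)).symm (chartAt E (1 : G) (f ((chartAt E (1 : G)).symm u))) =
        f ((chartAt E (1 : G)).symm u) := by
  filter_upwards [hf.tendsto.eventually (chart_source_mem_nhds E (1 : G))] with u hu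
  exact (chartAt E (1 : G)).left_inv hu

theorem unique (hf : HasDerivAtOne f A) (hf' : HasDerivAtOne f B) : A = B :=
  hf.hasStrictFDerivAt.hasFDerivAt.unique hf'.hasStrictFDerivAt.hasFDerivAt

theorem comp (hg : HasDerivAtOne g B) (hf : HasDerivAtOne f A) :
    HasDerivAtOne (g ∘ f) (B ∘L A) where
  map_one := by simp [hf.map_one, hg.map_one]
  continuousAt := by
    refine ContinuousAt.comp ?_ hf.continuousAt
    rw [hf.map_one]
    exact hg.continuousAt
  hasStrictFDerivAt := by
    have h := hg.hasStrictFDerivAt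
    have hc : chartAt E (1 : G) (f ((chartAt E (1 : G)).symm (chartAt E (1 : G) 1))) =
        chartAt E (1 : G) 1 := by rw [chartAt_symm_chartAt_one, hf.map_one]
    rw [← hc] at h
    refine (HasStrictFDerivAt.comp (chartAt E (1 : G) 1) h
      hf.hasStrictFDerivAt).congr_of_eventuallyEq ?_
    filter_upwards [hf.eventually_symm_chartAt] with u hu
    simp only [Function.comp_apply, hu]

theorem id : HasDerivAtOne (fun x : G => x) (1 : E →L[ℝ] E) where
  map_one := rfl
  continuousAt := continuousAt_id
  hasStrictFDerivAt := by
    refine (hasStrictFDerivAt_id _).congr_of_eventuallyEq ?_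
    filter_upwards [chart_target_mem_nhds E (1 : G)] with u hu
    exact ((chartAt E (1 : G)).right_inv hu).symm

theorem const_one : HasDerivAtOne (fun _ : G => (1 : G)) (0 : E →L[ℝ] E) :=
  ⟨rfl, continuousAt_const, hasStrictFDerivAt_const _ _⟩

theorem iterate (hf : HasDerivAtOne f A) (n : ℕ) : HasDerivAtOne f^[n] (A ^ n) := by
  induction n with
  | zero => exact id
  | succ n ih => rw [Function.iterate_succ, pow_succ]; exact ih.comp hf

/-- A self-map whose derivative at `1` is invertible is a local homeomorphism at `1`. -/
theorem exists_openPartialHomeomorph [CompleteSpace E] (hf : HasDerivAtOne f A) (hA : IsUnit A) :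
    ∃ h : OpenPartialHomeomorph G G, 1 ∈ h.source ∧ Set.EqOn f h h.source := by
  obtain ⟨a, rfl⟩ := hA
  set e := chartAt E (1 : G)
  have hd : HasStrictFDerivAt (fun u => e (f (e.symm u)))
    (ContinuousLinearEquiv.unitsEquiv ℝ E a : E →L[ℝ] E) (e 1) := hf.hasStrictFDerivAt
  let k : OpenPartialHomeomorph E E := hd.toOpenPartialHomeomorph _
  have hk : ∀ u, k u = e (f (e.symm u)) := fun u =>
    congrFun (HasStrictFDerivAt.toOpenPartialHomeomorph_coe hd) u
  have h1 : e.symm (e 1) = 1 := chartAt_symm_chartAt_one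
  have hnhds : f ⁻¹' e.source ∈ 𝓝 1 :=
    hf.continuousAt.preimage_mem_nhds (hf.map_one.symm ▸ chart_source_mem_nhds E (1 : G))
  refine ⟨(e.trans (k.trans e.symm)).restr (f ⁻¹' e.source), ?_, fun x hx => ?_⟩
  · rw [OpenPartialHomeomorph.restr_source, OpenPartialHomeomorph.trans_source,
      OpenPartialHomeomorph.trans_source]
    refine ⟨⟨mem_chart_source E 1, HasStrictFDerivAt.mem_toOpenPartialHomeomorph_source hd, ?_⟩,
      mem_interior_iff_mem_nhds.2 hnhds⟩
    rw [Set.mem_preimage, hk, h1, hf.map_one]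
    exact mem_chart_target E 1
  · rw [OpenPartialHomeomorph.restr_source, OpenPartialHomeomorph.trans_source] at hx
    change f x = e.symm (k (e x))
    rw [hk, e.left_inv hx.1.1, e.left_inv (Set.mem_preimage.1 (interior_subset hx.2))]

variable [LieGroup 𝓘(ℝ, E) ∞ G]

theorem exists_of_contMDiff (hf : ContMDiff 𝓘(ℝ, E) 𝓘(ℝ, E) ∞ f) (h1 : f 1 = 1) :
    ∃ A : E →L[ℝ] E, HasDerivAtOne f A := by
  have h : ContMDiffAt 𝓘(ℝ, E) 𝓘(ℝ, E) ∞
      (fun u => chartAt E (1 : G) (f ((chartAt E (1 : G)).symm u))) (chartAt E (1 : G) 1) := by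
    refine ContMDiffAt.comp (I' := 𝓘(ℝ, E)) _ ?_ (hf.contMDiffAt.comp (I' := 𝓘(ℝ, E)) _ ?_)
    · rw [chartAt_symm_chartAt_one, h1]
      exact contMDiffAt_of_mem_maximalAtlas (IsManifold.chart_mem_maximalAtlas 1)
        (mem_chart_source E 1)
    · exact contMDiffAt_symm_of_mem_maximalAtlas (IsManifold.chart_mem_maximalAtlas 1)
        (mem_chart_target E 1)
  exact ⟨_, h1, hf.continuous.continuousAt,
    h.contDiffAt.hasStrictFDerivAt (by simp)⟩

/-- The derivative of a pointwise product is the sum of the derivatives, since the derivative of the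
multiplication at `(1, 1)` is the addition. -/
theorem mul (hf : HasDerivAtOne f A) (hg : HasDerivAtOne g B) :
    HasDerivAtOne (fun x => f x * g x) (A + B) := by
  have := topologicalGroup_of_lieGroup (G := G) 𝓘(ℝ, E) ∞
  set c := chartAt E (1 : G) 1 with hc
  set m : E × E → E := fun p =>
    chartAt E (1 : G) ((chartAt E (1 : G)).symm p.1 * (chartAt E (1 : G)).symm p.2)
  have hs : ContMDiffAt 𝓘(ℝ, E) 𝓘(ℝ, E) ∞ (chartAt E (1 : G)).symm c :=
    contMDiffAt_symm_of_mem_maximalAtlas (IsManifold.chart_mem_maximalAtlas 1)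
      (mem_chart_target E 1)
  have hm : ContMDiffAt 𝓘(ℝ, E × E) 𝓘(ℝ, E) ∞ m (c, c) := by
    refine ContMDiffAt.comp (I' := 𝓘(ℝ, E)) _ ?_
      (ContMDiffAt.mul (ContMDiffAt.comp (I' := 𝓘(ℝ, E)) (c, c) hs
          contDiff_fst.contMDiff.contMDiffAt)
        (ContMDiffAt.comp (I' := 𝓘(ℝ, E)) (c, c) hs contDiff_snd.contMDiff.contMDiffAt))
    have h1 : (chartAt E (1 : G)).symm c * (chartAt E (1 : G)).symm c = 1 := by
      rw [hc, chartAt_symm_chartAt_one, mul_one]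
    change ContMDiffAt _ _ _ _ ((chartAt E (1 : G)).symm c * (chartAt E (1 : G)).symm c)
    rw [h1]
    exact contMDiffAt_of_mem_maximalAtlas (IsManifold.chart_mem_maximalAtlas 1)
      (mem_chart_source E 1)
  obtain ⟨M, hM⟩ : ∃ M : E × E →L[ℝ] E, HasStrictFDerivAt m M (c, c) :=
    ⟨_, hm.contDiffAt.hasStrictFDerivAt (by simp)⟩
  -- the multiplication restricts to the identity on both axes
  have hl : ∀ v, M (v, 0) = v := by
    have h : HasFDerivAt (fun u => m (u, c)) (M ∘L ContinuousLinearMap.inl ℝ E E) c :=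
      HasFDerivAt.comp c (f := fun u => (u, c)) hM.hasFDerivAt (hasFDerivAt_prodMk_left c c)
    have h' : HasFDerivAt (fun u => m (u, c)) (.id ℝ E) c := by
      refine (hasFDerivAt_id c).congr_of_eventuallyEq ?_
      filter_upwards [chart_target_mem_nhds E (1 : G)] with u hu
      simp [m, hc, (chartAt E (1 : G)).right_inv hu]
    exact fun v => DFunLike.congr_fun (h.unique h') v
  have hr : ∀ v, M (0, v) = v := by
    have h : HasFDerivAt (fun u => m (c, u)) (M ∘L ContinuousLinearMap.inr ℝ E E) c :=
      HasFDerivAt.comp c (f := fun u => (c, u)) hM.hasFDerivAt (hasFDerivAt_prodMk_right c c)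
    have h' : HasFDerivAt (fun u => m (c, u)) (.id ℝ E) c := by
      refine (hasFDerivAt_id c).congr_of_eventuallyEq ?_
      filter_upwards [chart_target_mem_nhds E (1 : G)] with u hu
      simp [m, hc, (chartAt E (1 : G)).right_inv hu]
    exact fun v => DFunLike.congr_fun (h.unique h') v
  refine ⟨by simp [hf.map_one, hg.map_one], hf.continuousAt.mul hg.continuousAt, ?_⟩
  have hfc : chartAt E (1 : G) (f ((chartAt E (1 : G)).symm c)) = c := by
    rw [hc, chartAt_symm_chartAt_one, hf.map_one]
  have hgc : chartAt E (1 : G) (g ((chartAt E (1 : G)).symm c)) = c := by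
    rw [hc, chartAt_symm_chartAt_one, hg.map_one]
  have hM' := hM
  rw [show ((c, c) : E × E) = (chartAt E (1 : G) (f ((chartAt E (1 : G)).symm c)),
    chartAt E (1 : G) (g ((chartAt E (1 : G)).symm c))) by rw [hfc, hgc]] at hM'
  have h := HasStrictFDerivAt.comp c hM' (hf.hasStrictFDerivAt.prodMk hg.hasStrictFDerivAt)
  have hAB : M ∘L A.prod B = A + B := by
    ext v
    rw [ContinuousLinearMap.comp_apply, ContinuousLinearMap.prod_apply,
      show (A v, B v) = (A v, 0) + (0, B v) by simp, map_add, hl, hr]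
    rfl
  rw [hAB] at h
  refine h.congr_of_eventuallyEq ?_
  filter_upwards [hf.eventually_symm_chartAt, hg.eventually_symm_chartAt] with u hu hu'
  simp only [m, hu, hu']

theorem inv : HasDerivAtOne (fun x : G => x⁻¹) (-1 : E →L[ℝ] E) := by
  obtain ⟨A, hA⟩ := exists_of_contMDiff (contMDiff_inv 𝓘(ℝ, E) ∞ (G := G)) inv_one
  have h := id.mul hA
  simp only [mul_inv_cancel] at h
  rw [← eq_neg_of_add_eq_zero_right (h.unique const_one)]
  exact hA

end HasDerivAtOne

variable [LieGroup 𝓘(ℝ, E) ∞ G]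

/-- The adjoint representation of a nilpotent Lie group is unipotent: `Ad g - 1` is the derivative of
`x ↦ ⁅g, x⁆`, and some iterate of this map is constant. -/
theorem isNilpotent_sub_one_of_hasDerivAtOne_conj [Group.IsNilpotent G] {g : G} {A : E →L[ℝ] E}
    (hA : HasDerivAtOne (fun x : G => g * x * g⁻¹) A) : IsNilpotent (A - 1) := by
  have hd : HasDerivAtOne (fun x : G => ⁅g, x⁆) (A - 1) := by
    rw [sub_eq_add_neg]
    exact hA.mul HasDerivAtOne.inv
  obtain ⟨n, hn⟩ := (Subgroup.nilpotent_iff_lowerCentralSeries (G := G)).1 inferInstance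
  refine ⟨n, (hd.iterate n).unique ?_⟩
  have hmem : ∀ k x, (fun x : G => ⁅g, x⁆)^[k] x ∈ (⊤ : Subgroup G).lowerCentralSeries k := by
    intro k x
    induction k with
    | zero => trivial
    | succ k ih =>
      rw [Function.iterate_succ_apply']
      have h := Subgroup.commutator_mem_commutator (Subgroup.mem_top g) ih
      rwa [Subgroup.commutator_comm] at h
  convert HasDerivAtOne.const_one using 1
  funext x
  have := hmem n x
  rw [hn] at this
  exact Subgroup.mem_bot.1 this

/-- Squaring is a local homeomorphism of a nilpotent Lie group: near `g`, it is
`g * x ↦ g ^ 2 * (g⁻¹ * x * g * x)`, whose derivative `Ad g⁻¹ + 1` is invertible as `Ad g⁻¹` is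
unipotent. -/
theorem isLocalHomeomorph_mul_self [CompleteSpace E] [Group.IsNilpotent G] :
    IsLocalHomeomorph fun x : G => x * x := by
  have := topologicalGroup_of_lieGroup (G := G) 𝓘(ℝ, E) ∞
  refine IsLocalHomeomorph.mk _ fun g => ?_
  obtain ⟨A, hA⟩ := HasDerivAtOne.exists_of_contMDiff (E := E) (f := fun x : G => g⁻¹ * x * g⁻¹⁻¹)
    ((contMDiff_mul_right (I := 𝓘(ℝ, E)) (n := ∞) (a := g⁻¹⁻¹)).comp
      (contMDiff_mul_left (I := 𝓘(ℝ, E)) (n := ∞) (a := g⁻¹))) (by group)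
  have hunit : IsUnit (A + 1) := by
    have h2 : IsUnit (2 : E →L[ℝ] E) := by
      have := (IsUnit.mk0 (2 : ℝ) two_ne_zero).map (algebraMap ℝ (E →L[ℝ] E))
      rwa [map_ofNat] at this
    have := (isNilpotent_sub_one_of_hasDerivAtOne_conj hA).isUnit_add_left_of_commute h2
      (Commute.ofNat_right _ 2)
    rwa [show A + 1 = 2 + (A - 1) by rw [← one_add_one_eq_two]; abel]
  obtain ⟨h, h1, hh⟩ := (hA.mul HasDerivAtOne.id).exists_openPartialHomeomorph hunit
  refine ⟨(Homeomorph.mulLeft g⁻¹).toOpenPartialHomeomorph.trans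
    (h.trans (Homeomorph.mulLeft (g * g)).toOpenPartialHomeomorph), ?_, fun x hx => ?_⟩
  · simpa using h1
  · have hx' : g⁻¹ * x ∈ h.source := by simpa using hx
    have := hh hx'
    simp only at this
    simp only [OpenPartialHomeomorph.coe_trans, Homeomorph.toOpenPartialHomeomorph_apply,
      Function.comp_apply, Homeomorph.coe_mulLeft, ← this]
    group

/-- Squaring is expanding near `1`, where its derivative is `2`. -/
theorem eventually_norm_chartAt_mul_self :
    ∀ᶠ v in 𝓝 (chartAt E (1 : G) 1), 3 / 2 * ‖v - chartAt E (1 : G) 1‖ ≤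
      ‖chartAt E (1 : G) ((chartAt E (1 : G)).symm v * (chartAt E (1 : G)).symm v) -
        chartAt E (1 : G) 1‖ := by
  have h := (HasDerivAtOne.id (E := E) (G := G)).mul HasDerivAtOne.id
  filter_upwards [h.hasStrictFDerivAt.hasFDerivAt.isLittleO.def one_half_pos] with v hv
  rw [chartAt_symm_chartAt_one, mul_one] at hv
  set c := chartAt E (1 : G) 1
  have h2 : ((1 : E →L[ℝ] E) + 1) (v - c) = (2 : ℝ) • (v - c) := (two_smul ℝ (v - c)).symm
  rw [h2] at hv
  have h3 := norm_sub_norm_le ((2 : ℝ) • (v - c))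
    (chartAt E (1 : G) ((chartAt E (1 : G)).symm v * (chartAt E (1 : G)).symm v) - c)
  rw [norm_sub_rev] at hv
  rw [norm_smul, Real.norm_ofNat] at h3
  linarith

end LieGroups

end

theorem mainTheorem10
    {E : Type e} [NormedAddCommGroup E] [NormedSpace ℝ E] [FiniteDimensional ℝ E]
    (G : Type u) [TopologicalSpace G] [ChartedSpace E G] [Group G] [LieGroup 𝓘(ℝ, E) ∞ G]
    [SimplyConnectedSpace G] [Group.IsNilpotent G]
    (L : Subgroup G) [DiscreteTopology L] [CompactSpace (G ⧸ L)] :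
    ConditionStar.{u, v, w} (G ⧸ L) := by
  have := topologicalGroup_of_lieGroup (G := G) 𝓘(ℝ, E) ∞
  have : T1Space G := ChartedSpace.t1Space E G
  have : LocallyCompactSpace G := ChartedSpace.locallyCompactSpace E G
  have : LocallyPathConnectedSpace G := ChartedSpace.locallyPathConnectedSpace E G
  have hG : SingularCohomology.CompactsInCopiesOf E G :=
    compactsInCopiesOf_of_expanding (isLocalHomeomorph_mul_self (E := E)) (chartAt E 1)
      (mem_chart_source E 1) eventually_norm_chartAt_mul_self
  exact SingularCohomology.conditionStar_of_almostInvariantAcyclic L fun T _ _ =>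
    SingularCohomology.almostInvariantAcyclic_of_isPolycyclic hG
      (Subgroup.isPolycyclic_of_fg_of_isNilpotent (Subgroup.fg_of_discrete_of_cocompact L))
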